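/- Let $\Sigma$ be a finite alphabet. A hidden Markov model over $\Sigma$ with hidden states $S=\{1,\dots,n\}$ consists of a probability vector $\pi\in\mathbb R^{S}$, a row-stochastic matrix $M\in\mathbb R^{S\times S}$ and a row-stochastic matrix $E\in\mathbb R^{S\times\Sigma}$. Its process $(X_t)_{t\ge 1}$ starts in a state $s$ with probability $\pi_s$; in each step it emits the symbol $a$ with probability $E_{sa}$, where $s$ is its current state, and then moves to $s'$ with probability $M_{ss'}$. A quantum random walk parametrization over $\Sigma$ consists of a directed $K$-regular graph with vertex set $\Sigma$, whose edges are labelled $(a,x)$ with $a\in\Sigma$, $x\in\{1,\dots,K\}$, the edges leaving $a$ being the $(a,x)$, a unitary operator $U$ on $\mathbb C^{k}$, $k=K|\Sigma|$, with coordinates indexed by the edges, and $\psi_0\in\mathbb C^k$ with $\|\psi_0\|=1$. Its process $(X_t)_{t\ge1}$ starts with the wave function $\psi_0$; in each step the current $\psi$ is replaced by $U\psi$, the symbol $a$ is emitted with probability $\sum_x|(U\psi)_{(a,x)}|^2$, and then $U\psi$ is projected onto the coordinates $(a,x)$, $1\le x\le K$, and renormalized. Its state space is the real vector space of self-adjoint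 complex $k\times k$ matrices, of dimension $k^2$. Two processes with values in $\Sigma$ are equivalent if $\Pr(X_1=a_1,\dots,X_t=a_t)=\Pr(Y_1=a_1,\dots,Y_t=a_t)$ for all $t\ge 0$ and all $a_1,\dots,a_t\in\Sigma$. Theorem. There is an algorithm that, given two hidden Markov models over the same alphabet $\Sigma$, with $n_X$ and $n_Y$ hidden states, decides whether the two processes are equivalent, in $O(|\Sigma|\max\{n_X,n_Y\}^4)$ arithmetic operations. Likewise, there is an algorithm that, given two quantum random walk parametrizations over the same alphabet $\Sigma$, with state spaces of dimensions $n_X$ and $n_Y$, decides whether the two processes are equivalent, in $O(|\Sigma|\max\{n_X,n_Y\}^4)$ arithmetic operations. In both cases the implied constant is absolute, and the arithmetic is exact arithmetic on real numbers (on real and imaginary parts for quantum random walks), each operation having unit cost. -/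

import Mathlib

/-! ## Hidden Markov models -/

/-- A hidden Markov model with alphabet `Fin σ` and set of hidden states `Fin n`. -/
structure HMM (σ n : ℕ) where
  /-- initial probabilities -/
  init : Fin n → ℝ
  /-- transition probabilities: `trans s s'` is the probability to move from `s` to `s'` -/
  trans : Matrix (Fin n) (Fin n) ℝ
  /-- emission probabilities: `emit s a` is the probability that state `s` emits `a` -/
  emit : Matrix (Fin n) (Fin σ) ℝ
  init_nonneg : ∀ s, 0 ≤ init s
  init_sum : ∑ s, init s = 1
  trans_nonneg : ∀ s s', 0 ≤ trans s s'
  trans_sum : ∀ s, ∑ s', trans s s' = 1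
  emit_nonneg : ∀ s a, 0 ≤ emit s a
  emit_sum : ∀ s, ∑ a, emit s a = 1

namespace HMM

variable {σ n : ℕ}

/-- The probability that the process, being in the hidden state `s`, emits the word `w` during
its next `w.length` steps: it emits a symbol from `s`, moves to some state `s'`, emits from `s'`,
and so on. -/
def probFrom (M : HMM σ n) : Fin n → List (Fin σ) → ℝ
  | _, [] => 1
  | s, a :: w => M.emit s a * ∑ s', M.trans s s' * M.probFrom s' w

/-- The probability function of the process `(X_t)` given by `M`:
`M.prob [a₁, …, a_t] = Pr(X_1 = a₁, …, X_t = a_t)`. -/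
def prob (M : HMM σ n) (w : List (Fin σ)) : ℝ :=
  ∑ s, M.init s * M.probFrom s w

end HMM

/-! ## Quantum random walks -/

/-- A quantum random walk parametrization over the alphabet `Fin σ`. The directed graph has vertex
set `Fin σ`; each vertex `a` has exactly `K` outgoing edges, and they are labelled `(a, x)`,
`x : Fin K`; `head (a, x)` is the vertex that the edge `(a, x)` points to. Nothing else is asked of
the graph, so that `K`-regular graphs are included under every convention on in-degrees, loops and
parallel edges. -/
structure QRW (σ K : ℕ) where
  /-- the graph -/
  head : Fin σ × Fin K → Fin σ
  /-- the evolution operator -/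
  U : Matrix (Fin σ × Fin K) (Fin σ × Fin K) ℂ
  /-- the initial wave function -/
  ψ₀ : EuclideanSpace ℂ (Fin σ × Fin K)
  U_unitary : U ∈ Matrix.unitaryGroup (Fin σ × Fin K) ℂ
  norm_ψ₀ : ‖ψ₀‖ = 1

namespace QRW

variable {σ K : ℕ}

/-- Application of the evolution operator. -/
noncomputable def evolve (Q : QRW σ K) (ψ : EuclideanSpace ℂ (Fin σ × Fin K)) :
    EuclideanSpace ℂ (Fin σ × Fin K) :=
  WithLp.toLp 2 (Q.U.mulVec ψ.ofLp)

/-- The orthogonal projection onto the span of the basis vectors of the edges `(a, x)`. -/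
def project (a : Fin σ) (φ : EuclideanSpace ℂ (Fin σ × Fin K)) :
    EuclideanSpace ℂ (Fin σ × Fin K) :=
  WithLp.toLp 2 fun e => if e.1 = a then φ e else 0

/-- The collapse of a wave function after observation of `a`: project and renormalize. (It is the
zero vector if `a` had probability zero.) -/
noncomputable def collapse (a : Fin σ) (φ : EuclideanSpace ℂ (Fin σ × Fin K)) :
    EuclideanSpace ℂ (Fin σ × Fin K) :=
  ((‖project a φ‖⁻¹ : ℝ) : ℂ) • project a φ

/-- The probability that the walk, having the wave function `ψ`, emits the word `w` during its
next `w.length` steps: apply `U`, observe `a` with probability `∑ x, |(U ψ) (a, x)|²`, collapse,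
and go on. -/
noncomputable def probFrom (Q : QRW σ K) :
    EuclideanSpace ℂ (Fin σ × Fin K) → List (Fin σ) → ℝ
  | _, [] => 1
  | ψ, a :: w =>
      (∑ x, ‖Q.evolve ψ (a, x)‖ ^ 2) * Q.probFrom (collapse a (Q.evolve ψ)) w

/-- The probability function of the quantum random walk `(X_t)` given by `Q`:
`Q.prob [a₁, …, a_t] = Pr(X_1 = a₁, …, X_t = a_t)`. -/
noncomputable def prob (Q : QRW σ K) (w : List (Fin σ)) : ℝ :=
  Q.probFrom Q.ψ₀ w

/-- The dimension of the state space, the real vector space of self-adjoint complex matrices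
with rows and columns indexed by the edges. -/
noncomputable def stateSpaceDim (σ K : ℕ) : ℕ :=
  Module.finrank ℝ (selfAdjoint (Matrix (Fin σ × Fin K) (Fin σ × Fin K) ℂ))

end QRW

/-! ## Programs over the reals

A real RAM in structured form. Its memory consists of index registers holding natural numbers and
of two-dimensional arrays of real cells. A program is a finite object that has access to real
numbers only through exact arithmetic, rational constants and tests for zero. Every operation,
every read or write and every test is charged one unit. -/

namespace RealRAM

/-- A memory state: `idx x` is the content of the index register `x`, and `mem A i j` is the
content of the cell `[i][j]` of the array `A`. -/
structure State where
  idx : ℕ → ℕ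
  mem : ℕ → ℕ → ℕ → ℝ

/-- Index expressions. -/
inductive IExpr where
  | const (c : ℕ)
  | reg (x : ℕ)
  | add (e f : IExpr)
  | sub (e f : IExpr)
  | mul (e f : IExpr)

namespace IExpr

/-- Subtraction of indices is truncated at zero. -/
def eval (s : State) : IExpr → ℕ
  | const c => c
  | reg x => s.idx x
  | add e f => e.eval s + f.eval s
  | sub e f => e.eval s - f.eval s
  | mul e f => e.eval s * f.eval s

def cost : IExpr → ℕ
  | const _ => 1
  | reg _ => 1
  | add e f => e.cost + f.cost + 1
  | sub e f => e.cost + f.cost + 1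
  | mul e f => e.cost + f.cost + 1

end IExpr

/-- Real expressions; `cell A e f` is the content of the cell `[e][f]` of the array `A`. -/
inductive RExpr where
  | const (q : ℚ)
  | cell (A : ℕ) (e f : IExpr)
  | add (u v : RExpr)
  | sub (u v : RExpr)
  | mul (u v : RExpr)
  | div (u v : RExpr)

namespace RExpr

noncomputable def eval (s : State) : RExpr → ℝ
  | const q => (q : ℝ)
  | cell A e f => s.mem A (e.eval s) (f.eval s)
  | add u v => u.eval s + v.eval s
  | sub u v => u.eval s - v.eval s
  | mul u v => u.eval s * v.eval s
  | div u v => u.eval s / v.eval s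

/-- No division by zero occurs in the evaluation. -/
def Defined (s : State) : RExpr → Prop
  | const _ => True
  | cell _ _ _ => True
  | add u v => u.Defined s ∧ v.Defined s
  | sub u v => u.Defined s ∧ v.Defined s
  | mul u v => u.Defined s ∧ v.Defined s
  | div u v => u.Defined s ∧ v.Defined s ∧ v.eval s ≠ 0

def cost : RExpr → ℕ
  | const _ => 1
  | cell _ e f => e.cost + f.cost + 1
  | add u v => u.cost + v.cost + 1
  | sub u v => u.cost + v.cost + 1
  | mul u v => u.cost + v.cost + 1
  | div u v => u.cost + v.cost + 1

end RExpr

/-- Programs. -/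
inductive Program where
  /-- do nothing -/
  | skip
  /-- assign the value of `e` to the index register `x` -/
  | setIdx (x : ℕ) (e : IExpr)
  /-- assign the value of `u` to the cell `[e][f]` of the array `A` -/
  | setCell (A : ℕ) (e f : IExpr) (u : RExpr)
  | seq (P R : Program)
  /-- `if e < f then P else R` -/
  | ifLt (e f : IExpr) (P R : Program)
  /-- `if u = 0 then P else R` -/
  | ifZero (u : RExpr) (P R : Program)
  /-- `while e < f do P` -/
  | whileLt (e f : IExpr) (P : Program)

namespace State

def setIdx (s : State) (x v : ℕ) : State :=
  { s with idx := Function.update s.idx x v }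

noncomputable def setCell (s : State) (A i j : ℕ) (r : ℝ) : State :=
  { s with mem := fun A' i' j' => if A' = A ∧ i' = i ∧ j' = j then r else s.mem A' i' j' }

end State

/-- `Exec P s t s'`: started in the state `s`, the program `P` halts in the state `s'` after
exactly `t` units of cost, without any division by zero. -/
inductive Exec : Program → State → ℕ → State → Prop
  | skip (s : State) : Exec .skip s 1 s
  | setIdx (s : State) (x : ℕ) (e : IExpr) :
      Exec (.setIdx x e) s (e.cost + 1) (s.setIdx x (e.eval s))
  | setCell (s : State) (A : ℕ) (e f : IExpr) (u : RExpr) (hu : u.Defined s) :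
      Exec (.setCell A e f u) s (e.cost + f.cost + u.cost + 1)
        (s.setCell A (e.eval s) (f.eval s) (u.eval s))
  | seq {P R : Program} {s s₁ s₂ : State} {t₁ t₂ : ℕ}
      (hP : Exec P s t₁ s₁) (hR : Exec R s₁ t₂ s₂) : Exec (.seq P R) s (t₁ + t₂) s₂
  | ifLt_true {e f : IExpr} {P R : Program} {s s₁ : State} {t : ℕ}
      (h : e.eval s < f.eval s) (hP : Exec P s t s₁) :
      Exec (.ifLt e f P R) s (e.cost + f.cost + 1 + t) s₁
  | ifLt_false {e f : IExpr} {P R : Program} {s s₁ : State} {t : ℕ}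
      (h : ¬ e.eval s < f.eval s) (hR : Exec R s t s₁) :
      Exec (.ifLt e f P R) s (e.cost + f.cost + 1 + t) s₁
  | ifZero_true {u : RExpr} {P R : Program} {s s₁ : State} {t : ℕ} (hu : u.Defined s)
      (h : u.eval s = 0) (hP : Exec P s t s₁) :
      Exec (.ifZero u P R) s (u.cost + 1 + t) s₁
  | ifZero_false {u : RExpr} {P R : Program} {s s₁ : State} {t : ℕ} (hu : u.Defined s)
      (h : u.eval s ≠ 0) (hR : Exec R s t s₁) :
      Exec (.ifZero u P R) s (u.cost + 1 + t) s₁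
  | while_true {e f : IExpr} {P : Program} {s s₁ s₂ : State} {t₁ t₂ : ℕ}
      (h : e.eval s < f.eval s) (hP : Exec P s t₁ s₁)
      (hW : Exec (.whileLt e f P) s₁ t₂ s₂) :
      Exec (.whileLt e f P) s (e.cost + f.cost + 1 + t₁ + t₂) s₂
  | while_false {e f : IExpr} {P : Program} {s : State} (h : ¬ e.eval s < f.eval s) :
      Exec (.whileLt e f P) s (e.cost + f.cost + 1) s

/-- Runs are unique. -/
theorem Exec.unique {P : Program} {s s₁ s₂ : State} {t₁ t₂ : ℕ}
    (h₁ : Exec P s t₁ s₁) (h₂ : Exec P s t₂ s₂) : t₁ = t₂ ∧ s₁ = s₂ := by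
  induction h₁ generalizing t₂ s₂ with
  | skip s => cases h₂; exact ⟨rfl, rfl⟩
  | setIdx s x e => cases h₂; exact ⟨rfl, rfl⟩
  | setCell s A e f u hu => cases h₂; exact ⟨rfl, rfl⟩
  | seq hP hR ihP ihR =>
    cases h₂ with
    | seq hP' hR' =>
      obtain ⟨rfl, rfl⟩ := ihP hP'
      obtain ⟨rfl, rfl⟩ := ihR hR'
      exact ⟨rfl, rfl⟩
  | ifLt_true h hP ih =>
    cases h₂ with
    | ifLt_true h' hP' => obtain ⟨rfl, rfl⟩ := ih hP'; exact ⟨rfl, rfl⟩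
    | ifLt_false h' hP' => exact absurd h h'
  | ifLt_false h hP ih =>
    cases h₂ with
    | ifLt_true h' hP' => exact absurd h' h
    | ifLt_false h' hP' => obtain ⟨rfl, rfl⟩ := ih hP'; exact ⟨rfl, rfl⟩
  | ifZero_true hu h hP ih =>
    cases h₂ with
    | ifZero_true hu' h' hP' => obtain ⟨rfl, rfl⟩ := ih hP'; exact ⟨rfl, rfl⟩
    | ifZero_false hu' h' hP' => exact absurd h h'
  | ifZero_false hu h hP ih =>
    cases h₂ with
    | ifZero_true hu' h' hP' => exact absurd h' h
    | ifZero_false hu' h' hP' => obtain ⟨rfl, rfl⟩ := ih hP'; exact ⟨rfl, rfl⟩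
  | while_true h hP hW ihP ihW =>
    cases h₂ with
    | while_true h' hP' hW' =>
      obtain ⟨rfl, rfl⟩ := ihP hP'
      obtain ⟨rfl, rfl⟩ := ihW hW'
      exact ⟨rfl, rfl⟩
    | while_false h' => exact absurd h h'
  | while_false h =>
    cases h₂ with
    | while_true h' hP' hW' => exact absurd h' h
    | while_false h' => exact ⟨rfl, rfl⟩

/-- Started in the state `s`, the program `P` halts at a cost of at most `T`, with the answer `1`
in the index register `0` if `φ` holds and with the answer `0` there if `φ` fails. -/
def DecidesWithin (P : Program) (s : State) (T : ℕ) (φ : Prop) : Prop :=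
  ∃ (t : ℕ) (s' : State), Exec P s t s' ∧ t ≤ T ∧
    (φ → s'.idx 0 = 1) ∧ (¬ φ → s'.idx 0 = 0)

/-- A matrix as the content of an array, with zeros in the unused cells. -/
def matrixCells {m n : ℕ} (A : Fin m → Fin n → ℝ) (i j : ℕ) : ℝ :=
  if h : i < m ∧ j < n then A ⟨i, h.1⟩ ⟨j, h.2⟩ else 0

/-- A vector as the content of row `0` of an array. -/
def vectorCells {n : ℕ} (v : Fin n → ℝ) : ℕ → ℕ → ℝ :=
  matrixCells (m := 1) fun _ j => v j

/-- The initial contents of the index registers. -/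
def inputIdx (a b c : ℕ) : ℕ → ℕ
  | 0 => a
  | 1 => b
  | 2 => c
  | _ => 0

/-- The initial state for two hidden Markov models: the registers `0`, `1`, `2` hold the size of
the alphabet and the numbers of hidden states. -/
def hmmInput {σ m n : ℕ} (MX : HMM σ m) (MY : HMM σ n) : State where
  idx := inputIdx σ m n
  mem
    | 0 => vectorCells MX.init
    | 1 => matrixCells MX.trans
    | 2 => matrixCells MX.emit
    | 3 => vectorCells MY.init
    | 4 => matrixCells MY.trans
    | 5 => matrixCells MY.emit
    | _ => fun _ _ => 0

/-- The edge with a given number: the edge `(a, x)` has the number `a * K + x`. -/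
def edge {σ K : ℕ} (i : Fin (σ * K)) : Fin σ × Fin K := finProdFinEquiv.symm i

/-- The initial state for two quantum random walks: the registers `0`, `1`, `2` hold the size of
the alphabet and the numbers of edges per vertex, and complex numbers are given by their real and
imaginary parts. The graphs themselves are not made available to the program. -/
noncomputable def qrwInput {σ K L : ℕ} (QX : QRW σ K) (QY : QRW σ L) : State where
  idx := inputIdx σ K L
  mem
    | 0 => matrixCells fun i j => (QX.U (edge i) (edge j)).re
    | 1 => matrixCells fun i j => (QX.U (edge i) (edge j)).im
    | 2 => vectorCells fun i => (QX.ψ₀ (edge i)).re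
    | 3 => vectorCells fun i => (QX.ψ₀ (edge i)).im
    | 4 => matrixCells fun i j => (QY.U (edge i) (edge j)).re
    | 5 => matrixCells fun i j => (QY.U (edge i) (edge j)).im
    | 6 => vectorCells fun i => (QY.ψ₀ (edge i)).re
    | 7 => vectorCells fun i => (QY.ψ₀ (edge i)).im
    | _ => fun _ _ => 0

end RealRAM

/-
Both kinds of processes are given by weighted automata: the probability of a word is the value of a
fixed linear functional on a vector obtained from an initial vector by one linear map per letter.
For a hidden Markov model this is the vector of joint probabilities of the word and the current
state. For a quantum random walk observation is not linear in the wave function `ψ`, but it is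
linear in the unnormalized density matrix `ψ ψ*`, whose real and imaginary parts are the states of
a real automaton.

Two automata have the same weights iff all weights of their difference vanish, that is, iff its
functional vanishes on the reachable space, the smallest subspace that contains the initial vector
and is invariant under all steps. A basis of this space in an echelon form is found by adjoining the
images of all basis vectors in rounds: a round that does not add a dimension shows that the span is
invariant, so `N` rounds suffice in dimension `N`. A round treats `N * |Σ|` images, at `O(N ^ 2)`
operations for each product and each reduction, which makes `O(|Σ| * N ^ 4)` in total.
-/

open Matrix

/-- A weighted automaton over the alphabet `α` with the states `ι`: the word `a₁ ⋯ a_t` has the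
weight `init * step a₁ * ⋯ * step a_t * final`, where `init` is a row and `final` a column. -/
structure WeightedAutomaton (α ι R : Type*) where
  init : ι → R
  step : α → Matrix ι ι R
  final : ι → R

namespace WeightedAutomaton

variable {α ι κ R : Type*} [Fintype ι] [Fintype κ]

section Semiring

variable [Semiring R]

/-- The row of state weights that the automaton reaches from the row `v` by reading a word. -/
def run (A : WeightedAutomaton α ι R) (v : ι → R) (w : List α) : ι → R :=
  w.foldl (fun u a => u ᵥ* A.step a) v

/-- The weight of a word in a weighted automaton. -/
def weight (A : WeightedAutomaton α ι R) (w : List α) : R :=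
  A.run A.init w ⬝ᵥ A.final

@[simp]
theorem run_nil (A : WeightedAutomaton α ι R) (v : ι → R) : A.run v [] = v := rfl

@[simp]
theorem run_cons (A : WeightedAutomaton α ι R) (v : ι → R) (a : α) (w : List α) :
    A.run v (a :: w) = A.run (v ᵥ* A.step a) w := rfl

theorem run_append_singleton (A : WeightedAutomaton α ι R) (v : ι → R) (w : List α) (a : α) :
    A.run v (w ++ [a]) = A.run v w ᵥ* A.step a := by
  simp [run]

/-- The automaton with its states renamed. -/
def reindex (A : WeightedAutomaton α ι R) (e : ι ≃ κ) : WeightedAutomaton α κ R where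
  init := A.init ∘ e.symm
  step a := (A.step a).submatrix e.symm e.symm
  final := A.final ∘ e.symm

theorem run_reindex (A : WeightedAutomaton α ι R) (e : ι ≃ κ) (v : ι → R) (w : List α) :
    (A.reindex e).run (v ∘ e.symm) w = A.run v w ∘ e.symm := by
  induction w generalizing v with
  | nil => rfl
  | cons a w ih =>
    rw [run_cons, run_cons, ← ih]
    simp [reindex, submatrix_vecMul_equiv, Function.comp_assoc]

theorem weight_reindex (A : WeightedAutomaton α ι R) (e : ι ≃ κ) :
    (A.reindex e).weight = A.weight := by
  funext w
  calc (A.reindex e).run (A.init ∘ e.symm) w ⬝ᵥ (A.final ∘ e.symm)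
      = (A.run A.init w ∘ e.symm) ⬝ᵥ (A.final ∘ e.symm) := by rw [run_reindex]
    _ = A.weight w := comp_equiv_dotProduct_comp_equiv _ _ _

end Semiring

section Ring

variable [Ring R]

/-- The disjoint union of two automata with the final weights of the second one negated. -/
def difference (A : WeightedAutomaton α ι R) (B : WeightedAutomaton α κ R) :
    WeightedAutomaton α (ι ⊕ κ) R where
  init := Sum.elim A.init B.init
  step a := fromBlocks (A.step a) 0 0 (B.step a)
  final := Sum.elim A.final (-B.final)

theorem run_difference (A : WeightedAutomaton α ι R) (B : WeightedAutomaton α κ R) (u : ι → R)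
    (v : κ → R) (w : List α) :
    (A.difference B).run (Sum.elim u v) w = Sum.elim (A.run u w) (B.run v w) := by
  induction w generalizing u v with
  | nil => rfl
  | cons a w ih =>
    rw [run_cons, run_cons, run_cons, ← ih]
    simp [difference, vecMul_fromBlocks]

theorem weight_difference (A : WeightedAutomaton α ι R) (B : WeightedAutomaton α κ R)
    (w : List α) : (A.difference B).weight w = A.weight w - B.weight w := by
  calc (A.difference B).run (Sum.elim A.init B.init) w ⬝ᵥ Sum.elim A.final (-B.final)
      = Sum.elim (A.run A.init w) (B.run B.init w) ⬝ᵥ Sum.elim A.final (-B.final) := by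
        rw [run_difference]
    _ = A.weight w - B.weight w := by
        simp [sumElim_dotProduct_sumElim, weight, sub_eq_add_neg]

theorem weight_difference_eq_zero_iff (A : WeightedAutomaton α ι R)
    (B : WeightedAutomaton α κ R) : (A.difference B).weight = 0 ↔ A.weight = B.weight := by
  simp only [funext_iff, weight_difference, Pi.zero_apply, sub_eq_zero]

end Ring

section Complex

/-- A real automaton whose weights are the real parts of those of a complex automaton: the row
`x + y i` of complex state weights is represented by the row `(x, y)`. -/
def realForm (A : WeightedAutomaton α ι ℂ) : WeightedAutomaton α (ι ⊕ ι) ℝ where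
  init := Sum.elim (fun i => (A.init i).re) fun i => (A.init i).im
  step a := fromBlocks ((A.step a).map Complex.re) ((A.step a).map Complex.im)
    (-(A.step a).map Complex.im) ((A.step a).map Complex.re)
  final := Sum.elim (fun i => (A.final i).re) fun i => -(A.final i).im

theorem run_realForm (A : WeightedAutomaton α ι ℂ) (v : ι → ℂ) (w : List α) :
    A.realForm.run (Sum.elim (fun i => (v i).re) fun i => (v i).im) w =
      Sum.elim (fun i => (A.run v w i).re) fun i => (A.run v w i).im := by
  induction w generalizing v with
  | nil => rfl
  | cons a w ih =>
    rw [run_cons, run_cons, ← ih]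
    congr 1
    ext (j | j) <;>
      simp [realForm, vecMul, dotProduct, Finset.sum_add_distrib, sub_eq_add_neg, add_comm]

theorem weight_realForm (A : WeightedAutomaton α ι ℂ) (w : List α) :
    A.realForm.weight w = (A.weight w).re := by
  calc A.realForm.run (Sum.elim (fun i => (A.init i).re) fun i => (A.init i).im) w ⬝ᵥ
        Sum.elim (fun i => (A.final i).re) (fun i => -(A.final i).im)
      = Sum.elim (fun i => (A.run A.init w i).re) (fun i => (A.run A.init w i).im) ⬝ᵥ
        Sum.elim (fun i => (A.final i).re) (fun i => -(A.final i).im) := by rw [run_realForm]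
    _ = (A.weight w).re := by
      simp [weight, dotProduct, Finset.sum_sub_distrib,
        ← sub_eq_add_neg]

end Complex

section Field

variable [Field R]

/-- The span of the rows of state weights that are reached by reading words. -/
def reachable (A : WeightedAutomaton α ι R) : Submodule R (ι → R) :=
  Submodule.span R (Set.range (A.run A.init))

theorem init_mem_reachable (A : WeightedAutomaton α ι R) : A.init ∈ A.reachable :=
  Submodule.subset_span ⟨[], rfl⟩

theorem vecMul_step_mem_reachable (A : WeightedAutomaton α ι R) (a : α) {v : ι → R}
    (hv : v ∈ A.reachable) : v ᵥ* A.step a ∈ A.reachable := by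
  suffices A.reachable ≤ A.reachable.comap (vecMulLinear (A.step a)) from this hv
  refine Submodule.span_le.mpr ?_
  rintro _ ⟨w, rfl⟩
  exact Submodule.subset_span ⟨w ++ [a], A.run_append_singleton _ w a⟩

theorem reachable_le (A : WeightedAutomaton α ι R) {W : Submodule R (ι → R)}
    (hinit : A.init ∈ W) (hstep : ∀ a, ∀ v ∈ W, v ᵥ* A.step a ∈ W) : A.reachable ≤ W := by
  suffices ∀ w : List α, ∀ v ∈ W, A.run v w ∈ W by
    refine Submodule.span_le.mpr ?_
    rintro _ ⟨w, rfl⟩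
    exact this w _ hinit
  intro w
  induction w with
  | nil => exact fun v hv => hv
  | cons a _ ih => exact fun v hv => ih _ (hstep a v hv)

theorem weight_eq_zero_iff (A : WeightedAutomaton α ι R) :
    A.weight = 0 ↔ ∀ v ∈ A.reachable, v ⬝ᵥ A.final = 0 := by
  constructor
  · intro h v hv
    induction hv using Submodule.span_induction with
    | mem _ hv => obtain ⟨w, rfl⟩ := hv; exact congrFun h w
    | zero => exact zero_dotProduct _
    | add u v _ _ hu hv => rw [add_dotProduct, hu, hv, add_zero]
    | smul c v _ hv => rw [smul_dotProduct, hv, smul_zero]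
  · exact fun h => funext fun w => h _ (Submodule.subset_span ⟨w, rfl⟩)

/-- A lower approximation of the reachable space, as it is obtained from `init` by `r` rounds of
adjoining all images under the steps: each round that does not exhaust the reachable space raises
the dimension. -/
structure ReachableApprox (A : WeightedAutomaton α ι R) (r : ℕ) (W : Submodule R (ι → R)) :
    Prop where
  init_mem : A.init ∈ W
  le : W ≤ A.reachable
  finrank_or_eq : r ≤ Module.finrank R W ∨ W = A.reachable

variable {A : WeightedAutomaton α ι R} {r : ℕ} {W W' : Submodule R (ι → R)}

theorem ReachableApprox.succ (h : A.ReachableApprox r W) (hWW' : W ≤ W')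
    (hW' : W' ≤ A.reachable) (hstep : ∀ a, ∀ v ∈ W, v ᵥ* A.step a ∈ W') :
    A.ReachableApprox (r + 1) W' := by
  refine ⟨hWW' h.init_mem, hW', ?_⟩
  rcases h.finrank_or_eq with hr | rfl
  · rcases hWW'.eq_or_lt with rfl | hlt
    · exact .inr (h.le.antisymm (A.reachable_le h.init_mem hstep))
    · exact .inl (hr.trans_lt (Submodule.finrank_lt_finrank_of_lt hlt))
  · exact .inr (hW'.antisymm hWW')

theorem ReachableApprox.eq_reachable (h : A.ReachableApprox r W) (hr : Fintype.card ι ≤ r) :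
    W = A.reachable := by
  rcases h.finrank_or_eq with hrW | hW
  · have htop : W = ⊤ := Submodule.eq_top_of_finrank_eq <|
      le_antisymm W.finrank_le (by simpa using hr.trans hrW)
    exact h.le.antisymm (htop ▸ le_top)
  · exact hW

end Field

end WeightedAutomaton

namespace HMM

variable {σ n : ℕ}

theorem card_states_pos (M : HMM σ n) : 1 ≤ n := by
  by_contra! h
  obtain rfl : n = 0 := by omega
  simpa using M.init_sum

theorem card_alphabet_pos (M : HMM σ n) : 1 ≤ σ := by
  by_contra! h
  obtain rfl : σ = 0 := by omega
  simpa using M.emit_sum ⟨0, M.card_states_pos⟩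

/-- A hidden Markov model as a weighted automaton, whose steps are emission and transition. -/
def toAutomaton (M : HMM σ n) : WeightedAutomaton (Fin σ) (Fin n) ℝ where
  init := M.init
  step a := Matrix.of fun s s' => M.emit s a * M.trans s s'
  final := 1

theorem run_toAutomaton_dotProduct_one (M : HMM σ n) (v : Fin n → ℝ) (w : List (Fin σ)) :
    M.toAutomaton.run v w ⬝ᵥ 1 = v ⬝ᵥ fun s => M.probFrom s w := by
  induction w generalizing v with
  | nil => rfl
  | cons a w ih =>
    have hstep : (M.toAutomaton.step a *ᵥ fun s => M.probFrom s w) =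
        fun s => M.probFrom s (a :: w) := by
      funext s
      simp [toAutomaton, probFrom, mulVec, dotProduct, Finset.mul_sum, mul_assoc]
    rw [WeightedAutomaton.run_cons, ih, ← dotProduct_mulVec, hstep]

theorem weight_toAutomaton (M : HMM σ n) : M.toAutomaton.weight = M.prob :=
  funext fun w => M.run_toAutomaton_dotProduct_one M.init w

end HMM

namespace QRW

variable {σ K : ℕ}

theorem card_edges_pos (Q : QRW σ K) : 1 ≤ σ * K := by
  by_contra! h
  have : IsEmpty (Fin σ × Fin K) := by
    rw [← Fintype.card_eq_zero_iff]
    simpa using h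
  simpa [Subsingleton.elim Q.ψ₀ 0] using Q.norm_ψ₀

theorem sq_le_stateSpaceDim (σ K : ℕ) : (σ * K) ^ 2 ≤ stateSpaceDim σ K := by
  let V := Matrix (Fin σ × Fin K) (Fin σ × Fin K) ℂ
  let parts : V →ₗ[ℝ] selfAdjoint V × selfAdjoint V := realPart.prod imaginaryPart
  have hparts : Function.Injective parts := fun x y hxy => by
    rw [← realPart_add_I_smul_imaginaryPart x, ← realPart_add_I_smul_imaginaryPart y,
      show realPart x = realPart y from congrArg Prod.fst hxy,
      show imaginaryPart x = imaginaryPart y from congrArg Prod.snd hxy]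
  have hfinite : Module.Finite ℝ (selfAdjoint V) :=
    Module.Finite.of_injective (selfAdjoint.submodule ℝ V).subtype Subtype.val_injective
  have hle : Module.finrank ℝ V ≤ stateSpaceDim σ K + stateSpaceDim σ K :=
    (LinearMap.finrank_le_finrank_of_injective hparts).trans_eq (Module.finrank_prod ..)
  have hV : Module.finrank ℝ V = 2 * (σ * K) ^ 2 := by
    rw [← Module.finrank_mul_finrank ℝ ℂ V, Complex.finrank_real_complex, Module.finrank_matrix]
    simp [sq]
  omega

/-- The squared norm of the wave function `ψ` after the observation of a word, if it is never
renormalized. -/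
noncomputable def sqNormAfter (Q : QRW σ K) :
    EuclideanSpace ℂ (Fin σ × Fin K) → List (Fin σ) → ℝ
  | ψ, [] => ‖ψ‖ ^ 2
  | ψ, a :: w => Q.sqNormAfter (project a (Q.evolve ψ)) w

theorem sqNormAfter_smul (Q : QRW σ K) (c : ℂ) (ψ : EuclideanSpace ℂ (Fin σ × Fin K))
    (w : List (Fin σ)) : Q.sqNormAfter (c • ψ) w = ‖c‖ ^ 2 * Q.sqNormAfter ψ w := by
  induction w generalizing ψ with
  | nil => simp [sqNormAfter, norm_smul, mul_pow]
  | cons a w ih =>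
    have hlinear : project a (Q.evolve (c • ψ)) = c • project a (Q.evolve ψ) := by
      ext e
      simp [project, evolve, mulVec_smul]
    rw [sqNormAfter, hlinear, ih, sqNormAfter]

theorem sum_norm_sq_eq_norm_project_sq (a : Fin σ) (φ : EuclideanSpace ℂ (Fin σ × Fin K)) :
    ∑ x, ‖φ (a, x)‖ ^ 2 = ‖project a φ‖ ^ 2 := by
  rw [EuclideanSpace.norm_sq_eq, Fintype.sum_prod_type, Finset.sum_eq_single a]
  · simp [project]
  · intro b _ hb
    simp [project, hb]
  · simp

theorem probFrom_eq_sqNormAfter (Q : QRW σ K) {ψ : EuclideanSpace ℂ (Fin σ × Fin K)}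
    (hψ : ‖ψ‖ = 1) (w : List (Fin σ)) : Q.probFrom ψ w = Q.sqNormAfter ψ w := by
  induction w generalizing ψ with
  | nil => simp [probFrom, sqNormAfter, hψ]
  | cons a w ih =>
    rw [probFrom, sqNormAfter, sum_norm_sq_eq_norm_project_sq]
    by_cases h : project a (Q.evolve ψ) = 0
    · simpa [h] using (Q.sqNormAfter_smul 0 0 w).symm
    · have hn : ‖project a (Q.evolve ψ)‖ ≠ 0 := norm_ne_zero_iff.mpr h
      have hunit : ‖collapse a (Q.evolve ψ)‖ = 1 := by
        simp [collapse, norm_smul, hn]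
      rw [ih hunit, collapse, sqNormAfter_smul, ← mul_assoc, ← mul_pow]
      simp [hn]

/-- The automaton of unnormalized density matrices: the wave function `ψ` is represented by
`ψ e * conj (ψ f)`, on which a step of the walk acts linearly. -/
noncomputable def densityAutomaton (Q : QRW σ K) :
    WeightedAutomaton (Fin σ) ((Fin σ × Fin K) × (Fin σ × Fin K)) ℂ where
  init p := Q.ψ₀ p.1 * star (Q.ψ₀ p.2)
  step a := Matrix.of fun p q =>
    if q.1.1 = a ∧ q.2.1 = a then Q.U q.1 p.1 * star (Q.U q.2 p.2) else 0
  final p := if p.1 = p.2 then 1 else 0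

theorem run_densityAutomaton_dotProduct_final (Q : QRW σ K)
    (ψ : EuclideanSpace ℂ (Fin σ × Fin K)) (w : List (Fin σ)) :
    Q.densityAutomaton.run (fun p => ψ p.1 * star (ψ p.2)) w ⬝ᵥ Q.densityAutomaton.final =
      Q.sqNormAfter ψ w := by
  induction w generalizing ψ with
  | nil =>
    simp [densityAutomaton, sqNormAfter, dotProduct, Fintype.sum_prod_type,
      EuclideanSpace.norm_sq_eq, Complex.mul_conj']
  | cons a w ih =>
    rw [sqNormAfter, ← ih, WeightedAutomaton.run_cons]
    congr 2
    funext q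
    by_cases hq : q.1.1 = a ∧ q.2.1 = a
    · calc ∑ p, ψ p.1 * star (ψ p.2) * Q.densityAutomaton.step a p q
          = ∑ p : (Fin σ × Fin K) × (Fin σ × Fin K),
              Q.U q.1 p.1 * ψ p.1 * (star (Q.U q.2 p.2) * star (ψ p.2)) := by
            refine Finset.sum_congr rfl fun p _ => ?_
            simp only [densityAutomaton, of_apply, if_pos hq]
            ring
        _ = Q.evolve ψ q.1 * star (Q.evolve ψ q.2) := by
            simp only [evolve, mulVec, dotProduct, star_sum, star_mul', Finset.sum_mul_sum]
            exact Fintype.sum_prod_type _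
        _ = project a (Q.evolve ψ) q.1 * star (project a (Q.evolve ψ) q.2) := by
            simp [project, hq]
    · rcases not_and_or.mp hq with h | h <;> simp [densityAutomaton, vecMul, dotProduct, project, h]

theorem weight_densityAutomaton (Q : QRW σ K) (w : List (Fin σ)) :
    Q.densityAutomaton.weight w = Q.prob w := by
  rw [prob, probFrom_eq_sqNormAfter Q Q.norm_ψ₀]
  exact Q.run_densityAutomaton_dotProduct_final Q.ψ₀ w

/-- The density matrix automaton over the reals, its states numbered as in `RealRAM.edge`: the
real part of the entry `(e, f)` has the number `f + k * e` and its imaginary part the number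
`k * k + (f + k * e)`, where `k = σ * K`. -/
noncomputable def toAutomaton (Q : QRW σ K) :
    WeightedAutomaton (Fin σ) (Fin (σ * K * (σ * K) + σ * K * (σ * K))) ℝ :=
  let e : (Fin σ × Fin K) × (Fin σ × Fin K) ≃ Fin (σ * K * (σ * K)) :=
    (finProdFinEquiv.prodCongr finProdFinEquiv).trans finProdFinEquiv
  Q.densityAutomaton.realForm.reindex ((e.sumCongr e).trans finSumFinEquiv)

theorem weight_toAutomaton (Q : QRW σ K) : Q.toAutomaton.weight = Q.prob := by
  funext w
  rw [toAutomaton, WeightedAutomaton.weight_reindex, WeightedAutomaton.weight_realForm,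
    weight_densityAutomaton, Complex.ofReal_re]

section Entries

variable (Q : QRW σ K) (a : Fin σ) (e f q q' : Fin (σ * K))
open RealRAM (edge)

theorem toAutomaton_init_castAdd :
    Q.toAutomaton.init (Fin.castAdd _ (finProdFinEquiv (e, f))) =
      (Q.densityAutomaton.init (edge e, edge f)).re := by
  simp [toAutomaton, WeightedAutomaton.reindex, WeightedAutomaton.realForm, edge]

theorem toAutomaton_init_natAdd :
    Q.toAutomaton.init (Fin.natAdd _ (finProdFinEquiv (e, f))) =
      (Q.densityAutomaton.init (edge e, edge f)).im := by
  simp [-Fin.natAdd_eq_addNat, toAutomaton, WeightedAutomaton.reindex, WeightedAutomaton.realForm,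
    edge]

theorem toAutomaton_step_castAdd_castAdd :
    Q.toAutomaton.step a (Fin.castAdd _ (finProdFinEquiv (e, f)))
        (Fin.castAdd _ (finProdFinEquiv (q, q'))) =
      (Q.densityAutomaton.step a (edge e, edge f) (edge q, edge q')).re := by
  simp [toAutomaton, WeightedAutomaton.reindex, WeightedAutomaton.realForm, edge]

theorem toAutomaton_step_castAdd_natAdd :
    Q.toAutomaton.step a (Fin.castAdd _ (finProdFinEquiv (e, f)))
        (Fin.natAdd _ (finProdFinEquiv (q, q'))) =
      (Q.densityAutomaton.step a (edge e, edge f) (edge q, edge q')).im := by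
  simp [-Fin.natAdd_eq_addNat, toAutomaton, WeightedAutomaton.reindex, WeightedAutomaton.realForm,
    edge]

theorem toAutomaton_step_natAdd_castAdd :
    Q.toAutomaton.step a (Fin.natAdd _ (finProdFinEquiv (e, f)))
        (Fin.castAdd _ (finProdFinEquiv (q, q'))) =
      -(Q.densityAutomaton.step a (edge e, edge f) (edge q, edge q')).im := by
  simp [-Fin.natAdd_eq_addNat, toAutomaton, WeightedAutomaton.reindex, WeightedAutomaton.realForm,
    edge]

theorem toAutomaton_step_natAdd_natAdd :
    Q.toAutomaton.step a (Fin.natAdd _ (finProdFinEquiv (e, f)))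
        (Fin.natAdd _ (finProdFinEquiv (q, q'))) =
      (Q.densityAutomaton.step a (edge e, edge f) (edge q, edge q')).re := by
  simp [-Fin.natAdd_eq_addNat, toAutomaton, WeightedAutomaton.reindex, WeightedAutomaton.realForm,
    edge]

theorem toAutomaton_final_castAdd :
    Q.toAutomaton.final (Fin.castAdd _ (finProdFinEquiv (e, f))) = if e = f then 1 else 0 := by
  simp [-finProdFinEquiv_symm_apply, toAutomaton, WeightedAutomaton.reindex,
    WeightedAutomaton.realForm, densityAutomaton, apply_ite Complex.re]

theorem toAutomaton_final_natAdd (l : Fin (σ * K * (σ * K))) :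
    Q.toAutomaton.final (Fin.natAdd _ l) = 0 := by
  simp [-Fin.natAdd_eq_addNat, toAutomaton, WeightedAutomaton.reindex, WeightedAutomaton.realForm,
    densityAutomaton, apply_ite Complex.im]

theorem toAutomaton_step_eq_zero {a : Fin σ} {j : Fin (σ * K * (σ * K))}
    (hj : ¬∃ x x', j = finProdFinEquiv (finProdFinEquiv (a, x), finProdFinEquiv (a, x')))
    (i : Fin (σ * K * (σ * K) + σ * K * (σ * K))) :
    Q.toAutomaton.step a i (Fin.castAdd _ j) = 0 ∧ Q.toAutomaton.step a i (Fin.natAdd _ j) = 0 := by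
  obtain ⟨⟨q, q'⟩, rfl⟩ := finProdFinEquiv.surjective j
  have hstep (p : (Fin σ × Fin K) × (Fin σ × Fin K)) :
      Q.densityAutomaton.step a p (edge q, edge q') = 0 :=
    if_neg fun ⟨hq, hq'⟩ => hj ⟨(edge q).2, (edge q').2, congrArg finProdFinEquiv <| Prod.ext
      (finProdFinEquiv.symm_apply_eq.mp (Prod.ext hq rfl))
      (finProdFinEquiv.symm_apply_eq.mp (Prod.ext hq' rfl))⟩
  induction i using Fin.addCases with
  | left i | right i =>
    obtain ⟨⟨e, f⟩, rfl⟩ := finProdFinEquiv.surjective i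
    simp only [toAutomaton_step_castAdd_castAdd, toAutomaton_step_castAdd_natAdd,
      toAutomaton_step_natAdd_castAdd, toAutomaton_step_natAdd_natAdd, hstep, Complex.zero_re,
      Complex.zero_im, neg_zero, and_self]

end Entries

end QRW

section Echelon

variable {N j : ℕ} {F : Type*} [Field F]

/-- The space spanned by the rows of a matrix. -/
def rowSpan (B : Matrix (Fin N) (Fin N) F) : Submodule F (Fin N → F) :=
  Submodule.span F (Set.range B.row)

theorem row_mem_rowSpan (B : Matrix (Fin N) (Fin N) F) (r : Fin N) : B.row r ∈ rowSpan B :=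
  Submodule.subset_span ⟨r, rfl⟩

theorem rowSpan_le_iff {B : Matrix (Fin N) (Fin N) F} {W : Submodule F (Fin N → F)} :
    rowSpan B ≤ W ↔ ∀ r, B.row r ∈ W := by
  rw [rowSpan, Submodule.span_le, Set.range_subset_iff]
  rfl

/-- A row echelon form in which each nonzero row has its pivot on the diagonal. -/
structure IsDiagonalEchelon (B : Matrix (Fin N) (Fin N) F) : Prop where
  blockTriangular : B.BlockTriangular id
  row_eq_zero : ∀ r, B r r = 0 → B.row r = 0

theorem isDiagonalEchelon_zero : IsDiagonalEchelon (0 : Matrix (Fin N) (Fin N) F) :=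
  ⟨blockTriangular_zero, fun _ _ => rfl⟩

/-- The state `(B, v)` of Gaussian elimination of the vector `v₀` by the rows of `B₀`, after the
first `j` columns have been dealt with; the remainder `v` becomes a new row when the pivot that it
needs is missing. -/
structure Elimination (B₀ : Matrix (Fin N) (Fin N) F) (v₀ : Fin N → F) (j : ℕ)
    (B : Matrix (Fin N) (Fin N) F) (v : Fin N → F) : Prop where
  isDiagonalEchelon : IsDiagonalEchelon B
  entry_eq_zero : ∀ i : Fin N, i.val < j → v i = 0
  span_eq : rowSpan B ⊔ Submodule.span F {v} = rowSpan B₀ ⊔ Submodule.span F {v₀}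
  row_eq : ∀ r, B₀ r r ≠ 0 → B.row r = B₀.row r

namespace Elimination

variable {B₀ B : Matrix (Fin N) (Fin N) F} {v₀ v : Fin N → F}

theorem refl (hB : IsDiagonalEchelon B) (v : Fin N → F) : Elimination B v 0 B v :=
  ⟨hB, fun _ h => absurd h (Nat.not_lt_zero _), rfl, fun _ _ => rfl⟩

theorem of_entry_eq_zero {j : Fin N} (h : Elimination B₀ v₀ j B v) (hv : v j = 0) :
    Elimination B₀ v₀ (j + 1) B v := by
  refine { h with entry_eq_zero := fun i hi => ?_ }
  rcases Nat.lt_succ_iff_lt_or_eq.mp hi with hi | hi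
  · exact h.entry_eq_zero i hi
  · rwa [Fin.ext hi]

theorem updateRow {j : Fin N} (h : Elimination B₀ v₀ j B v) (hv : v j ≠ 0) (hB : B j j = 0) :
    Elimination B₀ v₀ j (B.updateRow j v) v := by
  have hrow : ∀ r ≠ j, (B.updateRow j v).row r = B.row r := fun r hr =>
    updateRow_ne hr
  have hrow_self : (B.updateRow j v).row j = v := updateRow_self
  refine ⟨⟨fun r i hi => ?_, fun r hr => ?_⟩, h.entry_eq_zero, ?_, fun r hr => ?_⟩
  · rcases eq_or_ne r j with rfl | hrj
    · exact (congrFun hrow_self i).trans (h.entry_eq_zero i hi)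
    · exact (congrFun (hrow r hrj) i).trans (h.isDiagonalEchelon.blockTriangular hi)
  · rcases eq_or_ne r j with rfl | hrj
    · exact absurd ((congrFun hrow_self r).symm.trans hr) hv
    · rw [hrow r hrj]
      exact h.isDiagonalEchelon.row_eq_zero r ((congrFun (hrow r hrj) r).symm.trans hr)
  · rw [← h.span_eq]
    refine le_antisymm (sup_le (rowSpan_le_iff.mpr fun r => ?_) le_sup_right)
      (sup_le (rowSpan_le_iff.mpr fun r => ?_) le_sup_right)
    · rcases eq_or_ne r j with rfl | hrj
      · rw [hrow_self]
        exact Submodule.mem_sup_right (Submodule.mem_span_singleton_self v)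
      · rw [hrow r hrj]
        exact Submodule.mem_sup_left (row_mem_rowSpan B r)
    · rcases eq_or_ne r j with rfl | hrj
      · rw [h.isDiagonalEchelon.row_eq_zero r hB]
        exact Submodule.zero_mem _
      · rw [← hrow r hrj]
        exact Submodule.mem_sup_left (row_mem_rowSpan _ r)
  · rcases eq_or_ne r j with rfl | hrj
    · exact absurd ((congrFun (h.row_eq r hr) r).symm.trans hB) hr
    · rw [hrow r hrj, h.row_eq r hr]

theorem eliminate {j : Fin N} (h : Elimination B₀ v₀ j B v) (hB : B j j ≠ 0) :
    Elimination B₀ v₀ (j + 1) B (v - (v j / B j j) • B.row j) := by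
  refine ⟨h.isDiagonalEchelon, fun i hi => ?_, ?_, h.row_eq⟩
  · rcases Nat.lt_succ_iff_lt_or_eq.mp hi with hi | hi
    · simp [h.entry_eq_zero i hi, h.isDiagonalEchelon.blockTriangular (show id i < id j from hi)]
    · simp [Fin.ext hi, hB]
  · have hmem : (v j / B j j) • B.row j ∈ rowSpan B :=
      Submodule.smul_mem _ _ (row_mem_rowSpan B j)
    rw [← h.span_eq]
    refine le_antisymm (sup_le le_sup_left ?_) (sup_le le_sup_left ?_) <;>
      rw [Submodule.span_singleton_le_iff_mem]
    · exact Submodule.sub_mem _ (Submodule.mem_sup_right (Submodule.mem_span_singleton_self v))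
        (Submodule.mem_sup_left hmem)
    · have hmem' := Submodule.mem_span_singleton_self (R := F) (v - (v j / B j j) • B.row j)
      simpa only [sub_add_cancel] using Submodule.add_mem _
        (Submodule.mem_sup_right hmem') (Submodule.mem_sup_left hmem)

theorem rowSpan_eq (h : Elimination B₀ v₀ N B v) :
    rowSpan B = rowSpan B₀ ⊔ Submodule.span F {v₀} := by
  have hv : v = 0 := funext fun i => h.entry_eq_zero i i.isLt
  rw [← h.span_eq, hv, Submodule.span_zero_singleton, sup_bot_eq]

theorem reachableApprox_zero {α : Type*} {A : WeightedAutomaton α (Fin N) F}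
    (h : Elimination 0 A.init N B v) : A.ReachableApprox 0 (rowSpan B) := by
  have hzero : rowSpan (0 : Matrix (Fin N) (Fin N) F) ≤ A.reachable :=
    rowSpan_le_iff.mpr fun _ => Submodule.zero_mem _
  refine ⟨?_, ?_, .inl (Nat.zero_le _)⟩ <;> rw [h.rowSpan_eq]
  · exact Submodule.mem_sup_right (Submodule.mem_span_singleton_self _)
  · exact sup_le hzero ((Submodule.span_singleton_le_iff_mem _ _).mpr A.init_mem_reachable)

end Elimination

/-- The state `B` of a round of adjoining the images of the rows of `B₀` to the echelon form `B₀`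
itself, when the images of the row `r` under the step `a` with `done r a` have been adjoined. -/
structure AdjoinImages {α : Type*} (A : WeightedAutomaton α (Fin N) F)
    (B₀ : Matrix (Fin N) (Fin N) F) (done : Fin N → α → Prop) (B : Matrix (Fin N) (Fin N) F) :
    Prop where
  isDiagonalEchelon : IsDiagonalEchelon B
  le : rowSpan B₀ ≤ rowSpan B
  le_reachable : rowSpan B ≤ A.reachable
  row_eq : ∀ r, B₀ r r ≠ 0 → B.row r = B₀.row r
  image_mem : ∀ r a, done r a → B₀.row r ᵥ* A.step a ∈ rowSpan B

namespace AdjoinImages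

variable {α : Type*} {A : WeightedAutomaton α (Fin N) F} {B₀ B B' : Matrix (Fin N) (Fin N) F}
  {done done' : Fin N → α → Prop}

theorem start (hB₀ : IsDiagonalEchelon B₀) (hle : rowSpan B₀ ≤ A.reachable)
    (hdone : ∀ r a, ¬ done r a) : AdjoinImages A B₀ done B₀ :=
  ⟨hB₀, le_rfl, hle, fun _ _ => rfl, fun r a h => absurd h (hdone r a)⟩

theorem of_imp (h : AdjoinImages A B₀ done B) (hdone : ∀ r a, done' r a → done r a) :
    AdjoinImages A B₀ done' B :=
  { h with image_mem := fun r a hra => h.image_mem r a (hdone r a hra) }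

/-- The row `r` of `B` may already differ from that of `B₀`, but only where the latter is zero. -/
theorem adjoin {v : Fin N → F} {r : Fin N} {a : α} (h : AdjoinImages A B₀ done B)
    (hB₀ : IsDiagonalEchelon B₀) (hE : Elimination B (B.row r ᵥ* A.step a) N B' v)
    (hdone : ∀ r' a', done' r' a' → done r' a' ∨ r' = r ∧ a' = a) :
    AdjoinImages A B₀ done' B' := by
  have hle : rowSpan B ≤ rowSpan B' := hE.rowSpan_eq ▸ le_sup_left
  refine ⟨hE.isDiagonalEchelon, h.le.trans hle, ?_, fun r' hr' => ?_, fun r' a' hd => ?_⟩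
  · rw [hE.rowSpan_eq]
    refine sup_le h.le_reachable ((Submodule.span_singleton_le_iff_mem _ _).mpr ?_)
    exact A.vecMul_step_mem_reachable a (h.le_reachable (row_mem_rowSpan B r))
  · have hrow := h.row_eq r' hr'
    rw [hE.row_eq r' (by rwa [show B r' r' = B₀ r' r' from congrFun hrow r']), hrow]
  · rcases hdone r' a' hd with hd | ⟨rfl, rfl⟩
    · exact hle (h.image_mem r' a' hd)
    · by_cases h0 : B₀ r' r' = 0
      · rw [hB₀.row_eq_zero r' h0, zero_vecMul]
        exact Submodule.zero_mem _
      · rw [← h.row_eq r' h0, hE.rowSpan_eq]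
        exact Submodule.mem_sup_right (Submodule.mem_span_singleton_self _)

theorem reachableApprox_succ {r : ℕ} (h : AdjoinImages A B₀ (fun _ _ => True) B)
    (hB₀ : A.ReachableApprox r (rowSpan B₀)) : A.ReachableApprox (r + 1) (rowSpan B) := by
  refine hB₀.succ h.le h.le_reachable fun a => ?_
  change rowSpan B₀ ≤ (rowSpan B).comap (vecMulLinear (A.step a))
  exact rowSpan_le_iff.mpr fun r => h.image_mem r a trivial

end AdjoinImages

end Echelon

theorem WeightedAutomaton.weight_eq_zero_iff_mulVec {α F : Type*} [Field F] {N : ℕ}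
    {A : WeightedAutomaton α (Fin N) F} {B : Matrix (Fin N) (Fin N) F}
    (h : rowSpan B = A.reachable) : A.weight = 0 ↔ B *ᵥ A.final = 0 := by
  rw [A.weight_eq_zero_iff, ← h]
  refine ⟨fun hB => funext fun r => hB _ (row_mem_rowSpan B r), fun hB v hv => ?_⟩
  have hle : rowSpan B ≤ LinearMap.ker ((dotProductBilin F F).flip A.final) :=
    rowSpan_le_iff.mpr fun r => congrFun hB r
  exact hle hv

namespace RealRAM

/-- The contents of all arrays. -/
abbrev Memory := ℕ → ℕ → ℕ → ℝ

namespace IExpr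

instance : Add IExpr := ⟨add⟩
instance : Mul IExpr := ⟨mul⟩
instance : Zero IExpr := ⟨const 0⟩
instance : One IExpr := ⟨const 1⟩

variable (s : State) (e f : IExpr)

@[simp] theorem eval_reg (x : ℕ) : (reg x).eval s = s.idx x := rfl
@[simp] theorem eval_add : (e + f).eval s = e.eval s + f.eval s := rfl
@[simp] theorem eval_mul : (e * f).eval s = e.eval s * f.eval s := rfl
@[simp] theorem eval_zero : (0 : IExpr).eval s = 0 := rfl

theorem eval_congr {s t : State} (h : t.idx = s.idx) (e : IExpr) : e.eval t = e.eval s := by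
  induction e <;> simp_all only [eval]

end IExpr

namespace RExpr

instance : Add RExpr := ⟨add⟩
instance : Sub RExpr := ⟨sub⟩
instance : Mul RExpr := ⟨mul⟩
instance : Div RExpr := ⟨div⟩
instance : Zero RExpr := ⟨const 0⟩
instance : One RExpr := ⟨const 1⟩

variable (s : State) (u v : RExpr)

@[simp] theorem eval_cell (A : ℕ) (e f : IExpr) :
    (cell A e f).eval s = s.mem A (e.eval s) (f.eval s) := rfl
@[simp] theorem eval_add : (u + v).eval s = u.eval s + v.eval s := rfl
@[simp] theorem eval_sub : (u - v).eval s = u.eval s - v.eval s := rfl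
@[simp] theorem eval_mul : (u * v).eval s = u.eval s * v.eval s := rfl
@[simp] theorem eval_div : (u / v).eval s = u.eval s / v.eval s := rfl
@[simp] theorem eval_zero : (0 : RExpr).eval s = 0 := Rat.cast_zero
@[simp] theorem eval_one : (1 : RExpr).eval s = 1 := Rat.cast_one

@[simp] theorem defined_cell (A : ℕ) (e f : IExpr) : (cell A e f).Defined s := trivial
@[simp] theorem defined_zero : (0 : RExpr).Defined s := trivial
@[simp] theorem defined_one : (1 : RExpr).Defined s := trivial
@[simp] theorem defined_add : (u + v).Defined s ↔ u.Defined s ∧ v.Defined s := .rfl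
@[simp] theorem defined_sub : (u - v).Defined s ↔ u.Defined s ∧ v.Defined s := .rfl
@[simp] theorem defined_mul : (u * v).Defined s ↔ u.Defined s ∧ v.Defined s := .rfl
@[simp] theorem defined_div :
    (u / v).Defined s ↔ u.Defined s ∧ v.Defined s ∧ v.eval s ≠ 0 := .rfl

end RExpr

local notation:30 P:31 ";;" R:30 => Program.seq P R

namespace Program

/-- `for x < y do P`, where the bound is the content of the register `y`. -/
def forLt (x y : ℕ) (P : Program) : Program :=
  setIdx x 0 ;; whileLt (.reg x) (.reg y) (P ;; setIdx x (.reg x + 1))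

/-- The total cost of the operations in the text of a program; the test of a loop counts twice, so
that its last evaluation is paid for. A run in which no operation is executed more than `m` times,
apart from those last evaluations, costs at most `m * P.size`. -/
def size : Program → ℕ
  | skip => 1
  | setIdx _ e => e.cost + 1
  | setCell _ e f u => e.cost + f.cost + u.cost + 1
  | seq P R => P.size + R.size
  | ifLt e f P R => e.cost + f.cost + 1 + (P.size + R.size)
  | ifZero u P R => u.cost + 1 + (P.size + R.size)
  | whileLt e f P => 2 * (e.cost + f.cost + 1) + P.size

/-- No assignment in the program goes to the index register `x`. -/
def keepsIdx (x : ℕ) : Program → Bool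
  | skip => true
  | setIdx y _ => x != y
  | setCell _ _ _ _ => true
  | seq P R => P.keepsIdx x && R.keepsIdx x
  | ifLt _ _ P R => P.keepsIdx x && R.keepsIdx x
  | ifZero _ P R => P.keepsIdx x && R.keepsIdx x
  | whileLt _ _ P => P.keepsIdx x

/-- No assignment in the program goes to the array `A`. -/
def keepsMem (A : ℕ) : Program → Bool
  | skip => true
  | setIdx _ _ => true
  | setCell B _ _ _ => A != B
  | seq P R => P.keepsMem A && R.keepsMem A
  | ifLt _ _ P R => P.keepsMem A && R.keepsMem A
  | ifZero _ P R => P.keepsMem A && R.keepsMem A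
  | whileLt _ _ P => P.keepsMem A

/-- The states agree wherever `P` makes no assignment. -/
structure Frame (P : Program) (s s' : State) : Prop where
  idx : ∀ x, P.keepsIdx x → s'.idx x = s.idx x
  mem : ∀ A, P.keepsMem A → s'.mem A = s.mem A

@[simp]
theorem keepsIdx_forLt (x y z : ℕ) (P : Program) :
    (forLt x y P).keepsIdx z ↔ P.keepsIdx z ∧ z ≠ x := by
  simp [forLt, keepsIdx, and_comm]

@[simp]
theorem keepsMem_forLt (x y A : ℕ) (P : Program) : (forLt x y P).keepsMem A = P.keepsMem A := by
  simp [forLt, keepsMem]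

theorem size_forLt (x y : ℕ) (P : Program) : (forLt x y P).size = P.size + 12 := by
  change 2 + (6 + (P.size + 4)) = P.size + 12
  omega

theorem one_le_size (P : Program) : 1 ≤ P.size := by
  induction P <;> simp only [size] <;> omega

end Program

open Program

theorem Program.Frame.refl (P : Program) (s : State) : P.Frame s s :=
  ⟨fun _ _ => rfl, fun _ _ => rfl⟩

theorem Program.Frame.trans {P : Program} {s₁ s₂ s₃ : State} (h : P.Frame s₁ s₂)
    (h' : P.Frame s₂ s₃) : P.Frame s₁ s₃ :=
  ⟨fun x hx => (h'.idx x hx).trans (h.idx x hx), fun A hA => (h'.mem A hA).trans (h.mem A hA)⟩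

theorem Program.Frame.of_imp {P R : Program} {s s' : State} (h : P.Frame s s')
    (hidx : ∀ x, R.keepsIdx x → P.keepsIdx x) (hmem : ∀ A, R.keepsMem A → P.keepsMem A) :
    R.Frame s s' :=
  ⟨fun x hx => h.idx x (hidx x hx), fun A hA => h.mem A (hmem A hA)⟩

theorem Program.Frame.seq {P R : Program} {s₁ s₂ s₃ : State} (hP : P.Frame s₁ s₂)
    (hR : R.Frame s₂ s₃) : (P ;; R).Frame s₁ s₃ := by
  refine (hP.of_imp ?_ ?_).trans (hR.of_imp ?_ ?_) <;> simp +contextual [keepsIdx, keepsMem]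

theorem Exec.frame {P : Program} {s s' : State} {t : ℕ} (h : Exec P s t s') : P.Frame s s' := by
  induction h with
  | skip s => exact .refl _ s
  | setIdx s x e => exact ⟨fun y hy => by simp_all [keepsIdx, State.setIdx], fun _ _ => rfl⟩
  | setCell s A e f u _ =>
    exact ⟨fun _ _ => rfl, fun B hB => by simp_all [keepsMem, State.setCell]⟩
  | seq _ _ ihP ihR => exact ihP.seq ihR
  | ifLt_true _ _ ih | ifLt_false _ _ ih | ifZero_true _ _ _ ih | ifZero_false _ _ _ ih =>
    refine ih.of_imp ?_ ?_ <;> simp +contextual [keepsIdx, keepsMem]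
  | while_true _ _ _ ihP ihW =>
    refine (ihP.of_imp ?_ ?_).trans ihW <;> simp +contextual [keepsIdx, keepsMem]
  | while_false _ => exact .refl _ _

/-- Started in `s`, the program `P` halts at a cost of at most `m * P.size` with memory contents
satisfying `Q`. -/
def Runs (P : Program) (s : State) (m : ℕ) (Q : Memory → Prop) : Prop :=
  ∃ t s', Exec P s t s' ∧ t ≤ m * P.size ∧ Q s'.mem

section Runs

variable {P R : Program} {s : State} {m m' x y n : ℕ} {Q Q' : Memory → Prop}

theorem Runs.mono (h : Runs P s m Q) (hm : m ≤ m') (hQ : ∀ μ, Q μ → Q' μ) : Runs P s m' Q' := by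
  obtain ⟨t, s', hexec, ht, hq⟩ := h
  exact ⟨t, s', hexec, ht.trans (Nat.mul_le_mul_right _ hm), hQ _ hq⟩

theorem Runs.and_frame (h : Runs P s m Q) :
    Runs P s m fun μ => Q μ ∧ ∀ A, P.keepsMem A → μ A = s.mem A := by
  obtain ⟨t, s', hexec, ht, hq⟩ := h
  exact ⟨t, s', hexec, ht, hq, hexec.frame.mem⟩

theorem Runs.skip (hm : 1 ≤ m) (h : Q s.mem) : Runs .skip s m Q :=
  ⟨1, s, .skip s, Nat.mul_pos hm (one_le_size _), h⟩

theorem Runs.setCell {A : ℕ} {e f : IExpr} {u : RExpr} (hm : 1 ≤ m) (hu : u.Defined s)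
    (h : Q (s.setCell A (e.eval s) (f.eval s) (u.eval s)).mem) : Runs (.setCell A e f u) s m Q :=
  ⟨_, _, .setCell s A e f u hu, Nat.le_mul_of_pos_left _ hm, h⟩

theorem Runs.seq (hP : Runs P s m Q) (hR : ∀ s', P.Frame s s' → Q s'.mem → Runs R s' m Q') :
    Runs (P ;; R) s m Q' := by
  obtain ⟨t₁, s₁, hexec₁, ht₁, hq₁⟩ := hP
  obtain ⟨t₂, s₂, hexec₂, ht₂, hq₂⟩ := hR s₁ hexec₁.frame hq₁
  exact ⟨_, s₂, hexec₁.seq hexec₂, (Nat.add_le_add ht₁ ht₂).trans_eq (Nat.mul_add ..).symm, hq₂⟩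

theorem Runs.setIdx_seq {e : IExpr} (hm : 1 ≤ m)
    (hR : Runs R (s.setIdx x (e.eval s)) m Q) : Runs (Program.setIdx x e ;; R) s m Q := by
  obtain ⟨t, s', hexec, ht, hq⟩ := hR
  exact ⟨_, s', .seq (.setIdx s x e) hexec,
    (Nat.add_le_add (Nat.le_mul_of_pos_left _ hm) ht).trans_eq (Nat.mul_add ..).symm, hq⟩

theorem Runs.ifZero {u : RExpr} (hm : 1 ≤ m) (hu : u.Defined s)
    (hP : u.eval s = 0 → Runs P s m Q) (hR : u.eval s ≠ 0 → Runs R s m Q) :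
    Runs (.ifZero u P R) s m Q := by
  by_cases h : u.eval s = 0
  · obtain ⟨t, s', hexec, ht, hq⟩ := hP h
    exact ⟨_, s', .ifZero_true hu h hexec, by simp only [size]; nlinarith, hq⟩
  · obtain ⟨t, s', hexec, ht, hq⟩ := hR h
    exact ⟨_, s', .ifZero_false hu h hexec, by simp only [size]; nlinarith, hq⟩

/-- The loop of `forLt` from the iteration `i` on, when `k` iterations are left. -/
theorem Runs.whileLt_aux (Inv : ℕ → Memory → Prop) (hxy : y ≠ x) (hx : P.keepsIdx x)
    (hPy : P.keepsIdx y)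
    (step : ∀ i < n, ∀ s', (forLt x y P).Frame s s' → s'.idx x = i → Inv i s'.mem →
      Runs P s' m (Inv (i + 1)))
    (k i : ℕ) (hk : i + k = n) (s' : State) (hs' : (forLt x y P).Frame s s') (hi : s'.idx x = i)
    (hn : s'.idx y = n) (hInv : Inv i s'.mem) :
    ∃ t s'', Exec (.whileLt (.reg x) (.reg y) (P ;; .setIdx x (.reg x + 1))) s' t s'' ∧
      t ≤ k * (m * P.size + 7) + 3 ∧ Inv n s''.mem := by
  induction k generalizing i s' with
  | zero =>
    obtain rfl : i = n := hk
    exact ⟨_, s', .while_false (by simp [hi, hn]), by simp [IExpr.cost], hInv⟩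
  | succ k ih =>
    obtain ⟨t₁, s₁, hexec₁, ht₁, hInv₁⟩ := step i (by omega) s' hs' hi hInv
    have hi₁ : s₁.idx x = i := (hexec₁.frame.idx x hx).trans hi
    have hframe : (forLt x y P).Frame s₁ (s₁.setIdx x (i + 1)) :=
      ⟨fun z hz => by simp [State.setIdx, ((keepsIdx_forLt ..).mp hz).2], fun _ _ => rfl⟩
    obtain ⟨t₂, s₂, hexec₂, ht₂, hInv₂⟩ := ih (i + 1) (by omega) (s₁.setIdx x (i + 1))
      ((hs'.trans (hexec₁.frame.of_imp (by simp +contextual) (by simp))).trans hframe)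
      (by simp [State.setIdx]) (by simp [State.setIdx, hxy, hexec₁.frame.idx y hPy, hn]) hInv₁
    have hincr : Exec (.setIdx x (.reg x + 1)) s₁ 4 (s₁.setIdx x (i + 1)) := by
      rw [← hi₁]
      exact .setIdx s₁ x (.reg x + 1)
    refine ⟨_, s₂, .while_true (by simp [hi, hn]; omega) (hexec₁.seq hincr) hexec₂, ?_, hInv₂⟩
    simp only [IExpr.cost]
    linarith

/-- The invariant speaks about the memory only, the index registers being under control by
`Frame`. -/
theorem Runs.forLt (Inv : ℕ → Memory → Prop) (hn : s.idx y = n) (hxy : y ≠ x)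
    (hx : P.keepsIdx x) (hPy : P.keepsIdx y) (hn₁ : 1 ≤ n) (hm : 1 ≤ m) (h₀ : Inv 0 s.mem)
    (step : ∀ i < n, ∀ s', (forLt x y P).Frame s s' → s'.idx x = i → Inv i s'.mem →
      Runs P s' m (Inv (i + 1))) :
    Runs (forLt x y P) s (n * m) (Inv n) := by
  obtain ⟨t, s', hexec, ht, hInv⟩ := Runs.whileLt_aux Inv hxy hx hPy step n 0 (zero_add n)
    (s.setIdx x 0) ⟨fun z hz => by simp [State.setIdx, ((keepsIdx_forLt ..).mp hz).2],
      fun _ _ => rfl⟩ (by simp [State.setIdx]) (by simp [State.setIdx, hxy, hn]) h₀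
  refine ⟨_, s', .seq (.setIdx s x 0) hexec, ?_, hInv⟩
  have hnm : n ≤ n * m := Nat.le_mul_of_pos_right n hm
  have hcost : (0 : IExpr).cost = 1 := rfl
  rw [size_forLt, hcost]
  nlinarith

end Runs

/-- The program assigns values of `Φ` to cells of the array `A`, among them all cells of `S`. Hence
all cells of `S`, and all cells that already hold their value of `Φ`, hold it in the end. -/
def Fills (P : Program) (s : State) (m A : ℕ) (Φ : ℕ → ℕ → ℝ) (S : ℕ → ℕ → Prop) : Prop :=
  Runs P s m fun μ => ∀ i j, S i j ∨ s.mem A i j = Φ i j → μ A i j = Φ i j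

section Fills

variable {P R : Program} {s : State} {m m' x y n A : ℕ} {Φ : ℕ → ℕ → ℝ} {S S' : ℕ → ℕ → Prop}

theorem Fills.mono (h : Fills P s m A Φ S) (hm : m ≤ m') (hS : ∀ i j, S' i j → S i j) :
    Fills P s m' A Φ S' :=
  Runs.mono h hm fun _ hμ i j hij => hμ i j (hij.imp_left (hS i j))

theorem Fills.setCell {e f : IExpr} {u : RExpr} (hm : 1 ≤ m) (hu : u.Defined s)
    (h : u.eval s = Φ (e.eval s) (f.eval s)) :
    Fills (.setCell A e f u) s m A Φ fun i j => e.eval s = i ∧ f.eval s = j := by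
  refine Runs.setCell hm hu fun i j hij => ?_
  simp only [State.setCell, true_and]
  grind

theorem Fills.seq (hP : Fills P s m A Φ S) (hR : ∀ s', P.Frame s s' → Fills R s' m A Φ S') :
    Fills (P ;; R) s m A Φ fun i j => S i j ∨ S' i j :=
  Runs.seq hP fun s' hs' hμ => Runs.mono (hR s' hs') le_rfl fun μ hμ' i j => by
    have := hμ i j; have := hμ' i j; grind

theorem Fills.forLt {S : ℕ → ℕ → ℕ → Prop} (hn : s.idx y = n) (hxy : y ≠ x)
    (hx : P.keepsIdx x) (hPy : P.keepsIdx y) (hn₁ : 1 ≤ n) (hm : 1 ≤ m)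
    (step : ∀ i < n, ∀ s', (forLt x y P).Frame s s' → s'.idx x = i → Fills P s' m A Φ (S i)) :
    Fills (forLt x y P) s (n * m) A Φ fun i j => ∃ k < n, S k i j := by
  refine Runs.forLt (fun k μ => ∀ i j, (∃ l < k, S l i j) ∨ s.mem A i j = Φ i j → μ A i j = Φ i j)
    hn hxy hx hPy hn₁ hm (by simp) ?_
  intro k hk s' hs' hxk hInv
  refine Runs.mono (step k hk s' hs' hxk) le_rfl fun μ hμ i j => ?_
  have := hInv i j; have := hμ i j
  simp only [Nat.lt_succ_iff_lt_or_eq, or_and_right, exists_or, exists_eq_left]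
  grind

/-- Nested loops, each given by its counter and the register that holds its bound, around the
assignment of `u` to the cell `[e][f]` of the array `A`. -/
def fill (L : List (ℕ × ℕ)) (A : ℕ) (e f : IExpr) (u : RExpr) : Program :=
  L.foldr (fun p => Program.forLt p.1 p.2) (.setCell A e f u)

/-- In the state `t`, the registers are as in `s`, except for the counters of the loops `L`, which
have values below their bounds. -/
structure Counts (L : List (ℕ × ℕ)) (s t : State) : Prop where
  idx : ∀ x ∉ L.map Prod.fst, t.idx x = s.idx x
  lt : ∀ p ∈ L, t.idx p.1 < s.idx p.2

section

variable {L : List (ℕ × ℕ)} {e f : IExpr} {u : RExpr}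

theorem keepsIdx_fill (hx : x ∉ L.map Prod.fst) : (fill L A e f u).keepsIdx x := by
  induction L with
  | nil => rfl
  | cons p L ih =>
    simp only [List.map_cons, List.mem_cons, not_or] at hx
    exact (keepsIdx_forLt ..).mpr ⟨ih hx.2, hx.1⟩

theorem keepsMem_fill {B : ℕ} (hB : B ≠ A) : (fill L A e f u).keepsMem B := by
  induction L with
  | nil => simpa [fill, keepsMem] using hB
  | cons p L ih => exact (keepsMem_forLt ..).trans ih

theorem counts_cons_iff {p : ℕ × ℕ} {s' t : State}
    (hidx : ∀ x ∉ (p :: L).map Prod.fst, s'.idx x = s.idx x) (hp : p.1 ∉ L.map Prod.fst)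
    (hbounds : ∀ q ∈ L, q.2 ∉ (p :: L).map Prod.fst) (hlt : s'.idx p.1 < s.idx p.2) :
    Counts (p :: L) s t ∧ t.idx p.1 = s'.idx p.1 ↔ Counts L s' t := by
  refine ⟨fun ⟨ht, htp⟩ => ⟨fun x hx => ?_, fun q hq => ?_⟩, fun ht =>
    ⟨⟨fun x hx => ?_, List.forall_mem_cons.mpr ⟨?_, fun q hq => ?_⟩⟩, ht.idx _ hp⟩⟩
  · by_cases hxp : x = p.1
    · rw [hxp, htp]
    · have hx' : x ∉ (p :: L).map Prod.fst := by simpa [hxp] using hx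
      rw [ht.idx x hx', hidx x hx']
  · rw [hidx _ (hbounds q hq)]
    exact ht.lt q (List.mem_cons_of_mem _ hq)
  · rw [ht.idx x fun h => hx (List.mem_cons_of_mem _ h), hidx x hx]
  · rwa [ht.idx _ hp]
  · rw [← hidx _ (hbounds q hq)]
    exact ht.lt q hq

theorem Fills.fill (hnodup : (L.map Prod.fst).Nodup) (hbounds : ∀ p ∈ L, p.2 ∉ L.map Prod.fst)
    (hpos : ∀ p ∈ L, 1 ≤ s.idx p.2)
    (hu : ∀ t, Counts L s t → (∀ B ≠ A, t.mem B = s.mem B) →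
      u.Defined t ∧ u.eval t = Φ (e.eval t) (f.eval t)) :
    Fills (fill L A e f u) s (L.map fun p => s.idx p.2).prod A Φ
      fun i j => ∃ t, Counts L s t ∧ e.eval t = i ∧ f.eval t = j := by
  induction L generalizing s with
  | nil =>
    obtain ⟨hdef, heval⟩ := hu s ⟨fun _ _ => rfl, by simp⟩ fun _ _ => rfl
    refine (Fills.setCell le_rfl hdef heval).mono le_rfl fun i j ⟨t, ht, hij⟩ => ?_
    have hidx : t.idx = s.idx := funext fun x => ht.idx x (by simp)
    rwa [e.eval_congr hidx, f.eval_congr hidx] at hij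
  | cons p L ih =>
    rw [List.map_cons, List.nodup_cons] at hnodup
    rw [List.forall_mem_cons] at hpos
    have hboundsL : ∀ q ∈ L, q.2 ∉ (p :: L).map Prod.fst := fun q hq =>
      hbounds q (List.mem_cons_of_mem _ hq)
    have hp := hbounds p List.mem_cons_self
    simp only [List.map_cons, List.mem_cons, not_or] at hp
    have hprod : 1 ≤ (L.map fun q => s.idx q.2).prod :=
      List.one_le_prod (List.forall_mem_map.mpr hpos.2)
    refine (Fills.forLt (S := fun k i j => ∃ t, (Counts (p :: L) s t ∧ t.idx p.1 = k) ∧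
        e.eval t = i ∧ f.eval t = j) rfl hp.1 (keepsIdx_fill hnodup.1) (keepsIdx_fill hp.2)
        hpos.1 hprod ?_).mono le_rfl ?_
    · rintro _ hk s' hs' rfl
      have hidx : ∀ x ∉ (p :: L).map Prod.fst, s'.idx x = s.idx x := fun x hx =>
        hs'.idx x (keepsIdx_fill (L := p :: L) hx)
      have hmem : ∀ B ≠ A, s'.mem B = s.mem B := fun B hB =>
        hs'.mem B (keepsMem_fill (L := p :: L) hB)
      have hiff {t : State} := counts_cons_iff (t := t) hidx hnodup.1 hboundsL hk
      have hmap : L.map (fun q => s'.idx q.2) = L.map fun q => s.idx q.2 :=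
        List.map_congr_left fun q hq => hidx _ (hboundsL q hq)
      rw [← hmap]
      refine (ih hnodup.2 (fun q hq h => hboundsL q hq (List.mem_cons_of_mem _ h))
        (fun q hq => (hpos.2 q hq).trans_eq (hidx _ (hboundsL q hq)).symm)
        fun t ht htmem => ?_).mono le_rfl fun i j ⟨t, ht, hij⟩ => ⟨t, hiff.mp ht, hij⟩
      exact hu t (hiff.mpr ht).1 fun B hB => (htmem B hB).trans (hmem B hB)
    · rintro i j ⟨t, ht, hij⟩
      exact ⟨t.idx p.1, ht.lt p List.mem_cons_self, t, ⟨ht, rfl⟩, hij⟩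

end

end Fills

@[simp]
theorem matrixCells_apply {m n : ℕ} (M : Fin m → Fin n → ℝ) (i : Fin m) (j : Fin n) :
    matrixCells M i j = M i j := by
  simp [matrixCells]

@[simp]
theorem vectorCells_apply {n : ℕ} (v : Fin n → ℝ) (j : Fin n) : vectorCells v 0 j = v j :=
  matrixCells_apply (m := 1) _ 0 j

theorem Counts.exists_fin {L : List (ℕ × ℕ)} {s t : State} {x y n : ℕ} (h : Counts L s t)
    (hxy : (x, y) ∈ L) (hn : s.idx y = n) : ∃ i : Fin n, t.idx x = i :=
  ⟨⟨t.idx x, hn ▸ h.lt _ hxy⟩, rfl⟩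

/-- The first cells of row `0` of an array, as a vector. -/
def vectorOf {N : ℕ} (c : ℕ → ℕ → ℝ) : Fin N → ℝ := fun j => c 0 j

/-- The upper left corner of an array, as a matrix. -/
def matrixOf {N : ℕ} (c : ℕ → ℕ → ℝ) : Matrix (Fin N) (Fin N) ℝ := Matrix.of fun i j => c i j

/-- The cell `[0][f]` of `A` becomes the sum of the values of `u`, in which the register `x` counts
up to the bound in `y`. -/
def sumInto (A : ℕ) (f : IExpr) (x y : ℕ) (u : RExpr) : Program :=
  .setCell A 0 f 0 ;; forLt x y (.setCell A 0 f (.cell A 0 f + u))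

theorem Fills.sumInto {s : State} {n A x y : ℕ} {f : IExpr} {u : RExpr} {Φ : ℕ → ℕ → ℝ}
    {g : ℕ → ℝ} (hn : s.idx y = n) (hxy : y ≠ x) (hn₁ : 1 ≤ n)
    (hf : ∀ t, Counts [(x, y)] s t → f.eval t = f.eval s)
    (hu : ∀ t, Counts [(x, y)] s t → (∀ B ≠ A, t.mem B = s.mem B) →
      u.Defined t ∧ u.eval t = g (t.idx x))
    (hΦ : ∑ i ∈ Finset.range n, g i = Φ 0 (f.eval s)) :
    Fills (sumInto A f x y u) s n A Φ fun i j => i = 0 ∧ j = f.eval s := by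
  let Inv (k : ℕ) (μ : Memory) : Prop := ∀ i j,
    μ A i j = if i = 0 ∧ j = f.eval s then ∑ l ∈ Finset.range k, g l else s.mem A i j
  have hloop : Runs (RealRAM.sumInto A f x y u) s n (Inv n) := by
    refine Runs.seq (Q := Inv 0) (Runs.setCell hn₁ trivial fun i j => ?_) fun s₁ hs₁ hInv => ?_
    · simp [State.setCell]
    refine (Runs.forLt Inv ((hs₁.idx y rfl).trans hn) hxy rfl rfl hn₁ le_rfl hInv
      fun k hk t ht htx hInv => ?_).mono (mul_one n).le fun _ => id
    have hcounts : Counts [(x, y)] s t :=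
      ⟨fun z hz => (ht.idx z (by simpa [keepsIdx] using hz)).trans (hs₁.idx z rfl),
        by simp [htx, hn, hk]⟩
    have hmem : ∀ B ≠ A, t.mem B = s.mem B := fun B hB =>
      (ht.mem B (by simpa [keepsMem] using hB)).trans (hs₁.mem B (by simpa [keepsMem] using hB))
    obtain ⟨hdef, heval⟩ := hu t hcounts hmem
    refine Runs.setCell le_rfl (by simpa using hdef) fun i j => ?_
    have h₀ := hInv 0 (f.eval s)
    have hij := hInv i j
    simp only [State.setCell, RExpr.eval_add, RExpr.eval_cell, IExpr.eval_zero, hf t hcounts, heval,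
      htx, Finset.sum_range_succ, true_and]
    grind
  refine Runs.mono hloop le_rfl fun μ hμ i j hij => ?_
  rw [hμ i j]
  grind

-- Memory layout. The register `0` holds the size of the alphabet, the registers `3`, `4` and `5`
-- the numbers of states of the two automata and of their difference, the registers `6` and `7` the
-- numbers of edges of two quantum random walks; the registers from `10` on are counters. The arrays
-- below `10` hold the input, and an automaton occupies three consecutive arrays.
abbrev regDimX : ℕ := 3
abbrev regDimY : ℕ := 4
abbrev regDim : ℕ := 5
abbrev arrX : ℕ := 10
abbrev arrY : ℕ := 13
abbrev arrAut : ℕ := 16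
abbrev arrBasis : ℕ := 20
abbrev arrVec : ℕ := 21
abbrev arrTmp : ℕ := 22
abbrev arrDots : ℕ := 23
abbrev arrNorm : ℕ := 24

section Elimination

variable {N : ℕ} {s : State}

theorem runs_fill_vector {A d : ℕ} {u : RExpr} {v : Fin N → ℝ} (hd : d ≠ 11) (hN : s.idx d = N)
    (hN₁ : 1 ≤ N)
    (hu : ∀ t (l : Fin N), Counts [(11, d)] s t → (∀ B ≠ A, t.mem B = s.mem B) →
      t.idx 11 = l → u.Defined t ∧ u.eval t = v l) :
    Runs (fill [(11, d)] A 0 (.reg 11) u) s N fun μ => vectorOf (μ A) = v := by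
  refine Runs.mono (Fills.fill (Φ := vectorCells v) (by simp) (by simpa) (by simp [hN, hN₁])
    fun t ht htmem => ?_) (by simp [hN]) fun μ hμ => funext fun l => ?_
  · obtain ⟨l, hl⟩ := ht.exists_fin List.mem_cons_self hN
    simpa [hl] using hu t l ht htmem hl
  · refine (hμ 0 l (.inl ⟨s.setIdx 11 l, ⟨?_, ?_⟩, ?_⟩)).trans (vectorCells_apply v l) <;>
      simp +contextual [State.setIdx, hN]

/-- Subtracts from the vector the multiple of the basis row numbered by the register `10` that
cancels the entry of the vector in that column. -/
def eliminate : Program :=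
  fill [(11, regDim)] arrTmp 0 (.reg 11)
    (.cell arrVec 0 (.reg 11) - .cell arrVec 0 (.reg 10) / .cell arrBasis (.reg 10) (.reg 10) *
      .cell arrBasis (.reg 10) (.reg 11)) ;;
  fill [(11, regDim)] arrVec 0 (.reg 11) (.cell arrTmp 0 (.reg 11))

theorem runs_eliminate {B : Matrix (Fin N) (Fin N) ℝ} {v : Fin N → ℝ} {j : Fin N}
    (hN : s.idx regDim = N) (hj : s.idx 10 = j) (hB : matrixOf (s.mem arrBasis) = B)
    (hv : vectorOf (s.mem arrVec) = v) (hpivot : B j j ≠ 0) :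
    Runs eliminate s N fun μ =>
      matrixOf (μ arrBasis) = B ∧ vectorOf (μ arrVec) = v - (v j / B j j) • B.row j := by
  subst hB hv
  refine Runs.seq (runs_fill_vector (v := vectorOf (s.mem arrVec) - (vectorOf (s.mem arrVec) j /
      matrixOf (s.mem arrBasis) j j) • (matrixOf (s.mem arrBasis)).row j) (by decide) hN j.pos ?_)
    fun s' hs' hs'mem => (Runs.and_frame (runs_fill_vector (by decide)
      ((hs'.idx _ (by decide)).trans hN) j.pos ?_)).mono le_rfl fun μ hμ => ⟨?_, hμ.1⟩
  · intro t l ht htmem hl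
    have h10 := (ht.idx 10 (by decide)).trans hj
    have hbasis := htmem arrBasis (by decide)
    have hvec := htmem arrVec (by decide)
    simp only [matrixOf, of_apply] at hpivot
    simp [hl, h10, hbasis, hvec, vectorOf, matrixOf, hpivot]
  · intro t l _ htmem hl
    have htmp := htmem arrTmp (by decide)
    rw [← hs'mem]
    simp [hl, htmp, vectorOf]
  · rw [hμ.2 _ (by decide), hs'.mem _ (by decide)]

/-- The vector becomes the basis row numbered by the register `10`. -/
def storeRow : Program :=
  fill [(11, regDim)] arrBasis (.reg 10) (.reg 11) (.cell arrVec 0 (.reg 11))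

theorem runs_storeRow {j : Fin N} (hN : s.idx regDim = N) (hj : s.idx 10 = j) :
    Runs storeRow s N fun μ => matrixOf (μ arrBasis) =
      (matrixOf (s.mem arrBasis)).updateRow j (vectorOf (s.mem arrVec)) := by
  refine Runs.mono (Fills.fill
      (Φ := matrixCells fun r l =>
        (matrixOf (s.mem arrBasis)).updateRow j (vectorOf (s.mem arrVec)) r l)
      (by decide) (by decide) (by simp [hN, Nat.succ_le_iff, j.pos]) fun t ht htmem => ?_)
    (by simp [hN]) fun μ hμ => ?_
  · obtain ⟨l, hl⟩ := ht.exists_fin List.mem_cons_self hN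
    simp [hl, ht.idx 10 (by decide), hj, htmem arrVec (by decide), vectorOf]
  · ext r l
    refine (hμ r l ?_).trans (matrixCells_apply _ r l)
    rcases eq_or_ne r j with rfl | hr
    · exact .inl ⟨s.setIdx 11 l, ⟨by simp +contextual [State.setIdx],
        by simp [State.setIdx, hN]⟩, by simp [State.setIdx, hj], by simp [State.setIdx]⟩
    · exact .inr (by simp [hr, matrixOf])

/-- Reduces the vector by the rows of the basis; at the first column with a nonzero entry and no
pivot, the remainder becomes the basis row of that column and the vector becomes zero. -/
def insert : Program :=
  forLt 10 regDim (.ifZero (.cell arrVec 0 (.reg 10)) .skip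
    (.ifZero (.cell arrBasis (.reg 10) (.reg 10)) storeRow .skip ;; eliminate))

theorem runs_insert {B : Matrix (Fin N) (Fin N) ℝ} {v : Fin N → ℝ} (hN : s.idx regDim = N)
    (hN₁ : 1 ≤ N) (hbasis : matrixOf (s.mem arrBasis) = B) (hvec : vectorOf (s.mem arrVec) = v)
    (hB : IsDiagonalEchelon B) :
    Runs insert s (N * N) fun μ => ∃ v', Elimination B v N (matrixOf (μ arrBasis)) v' := by
  refine (Runs.forLt (fun j μ => Elimination B v j (matrixOf (μ arrBasis)) (vectorOf (μ arrVec))) hN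
    (by decide) (by decide) (by decide) hN₁ hN₁ ?_ ?_).mono le_rfl fun μ hμ => ⟨_, hμ⟩
  · rw [hbasis, hvec]
    exact .refl hB v
  intro j hj s₁ hs₁ hs₁j hInv
  obtain ⟨j, rfl⟩ : ∃ i : Fin N, i.val = j := ⟨⟨j, hj⟩, rfl⟩
  have hN' : s₁.idx regDim = N := (hs₁.idx _ (by decide)).trans hN
  have hvec_eval : RExpr.eval s₁ (.cell arrVec 0 (.reg 10)) = vectorOf (s₁.mem arrVec) j := by
    simp [vectorOf, hs₁j]
  have hpivot_eval : RExpr.eval s₁ (.cell arrBasis (.reg 10) (.reg 10)) =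
      matrixOf (s₁.mem arrBasis) j j := by
    simp [matrixOf, hs₁j]
  refine Runs.ifZero hN₁ trivial (fun hv => Runs.skip hN₁ (hInv.of_entry_eq_zero (hvec_eval ▸ hv)))
    fun hv => ?_
  rw [hvec_eval] at hv
  refine Runs.seq (Q := fun μ => matrixOf (μ arrBasis) j j ≠ 0 ∧
    Elimination B v j (matrixOf (μ arrBasis)) (vectorOf (μ arrVec))) ?_
    fun s₂ hs₂ ⟨hpivot, hInv₂⟩ => Runs.mono (runs_eliminate ((hs₂.idx _ (by decide)).trans hN')
        ((hs₂.idx _ (by decide)).trans hs₁j) rfl rfl hpivot) le_rfl fun μ hμ => ?_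
  · refine Runs.ifZero hN₁ trivial (fun hpivot => ?_) fun hpivot => Runs.skip hN₁ ?_ <;>
      rw [hpivot_eval] at hpivot
    · refine Runs.mono (Runs.and_frame (runs_storeRow hN' hs₁j)) le_rfl fun μ ⟨hμ, hframe⟩ => ?_
      rw [hμ, hframe arrVec (by decide)]
      exact ⟨by simpa using hv, hInv.updateRow hv hpivot⟩
    · exact ⟨hpivot, hInv⟩
  · rw [hμ.1, hμ.2]
    exact hInv₂.eliminate hpivot

end Elimination

section WeightedAutomaton

variable {σ N : ℕ} {A : WeightedAutomaton (Fin σ) (Fin N) ℝ} {s : State}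

/-- A weighted automaton is stored in three arrays from number `b` on: its step matrices below each
other, its initial vector and its final vector. -/
structure Stores (A : WeightedAutomaton (Fin σ) (Fin N) ℝ) (b : ℕ) (μ : Memory) : Prop where
  step : ∀ (a : Fin σ) (i j : Fin N), μ b (i + N * a) j = A.step a i j
  init : ∀ i : Fin N, μ (b + 1) 0 i = A.init i
  final : ∀ i : Fin N, μ (b + 2) 0 i = A.final i

theorem Stores.congr {b : ℕ} {μ ν : Memory} (h : Stores A b μ) (hstep : ν b = μ b)
    (hinit : ν (b + 1) = μ (b + 1)) (hfinal : ν (b + 2) = μ (b + 2)) : Stores A b ν :=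
  ⟨hstep ▸ h.step, hinit ▸ h.init, hfinal ▸ h.final⟩

/-- Row `0` of `A` becomes the vector of the row sums of a square matrix with the entries `u`, rows
being counted by the register `10` and columns by the register `11`. -/
def rowSums (A : ℕ) (u : RExpr) : Program :=
  forLt 10 regDim (sumInto A (.reg 10) 11 regDim u)

theorem runs_rowSums {A : ℕ} {u : RExpr} {M : Matrix (Fin N) (Fin N) ℝ} (hN : s.idx regDim = N)
    (hN₁ : 1 ≤ N)
    (hu : ∀ t (j l : Fin N), (∀ x ∉ [10, 11], t.idx x = s.idx x) → (∀ B ≠ A, t.mem B = s.mem B) →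
      t.idx 10 = j.val → t.idx 11 = l.val → u.Defined t ∧ u.eval t = M j l) :
    Runs (rowSums A u) s (N * N) fun μ => vectorOf (μ A) = fun j => ∑ l, M j l := by
  refine Runs.mono (Fills.forLt (Φ := vectorCells fun j => ∑ l, M j l)
      (S := fun k i j => i = 0 ∧ j = k) hN (by decide) rfl rfl hN₁ hN₁ fun k hk s₁ hs₁ hs₁k => ?_)
    le_rfl fun μ hμ => funext fun j =>
      (hμ 0 j (.inl ⟨j, j.isLt, rfl, rfl⟩)).trans (vectorCells_apply _ j)
  obtain ⟨j, rfl⟩ : ∃ i : Fin N, i.val = k := ⟨⟨k, hk⟩, rfl⟩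
  have hN' : s₁.idx regDim = N := (hs₁.idx _ (by simp [sumInto, keepsIdx])).trans hN
  refine (Fills.sumInto (f := .reg 10) (g := matrixCells (fun i l => M i l) j) hN' (by decide) hN₁
    (fun t ht => ht.idx 10 (by decide)) (fun t ht htmem => ?_) ?_).mono le_rfl ?_
  · obtain ⟨l, hl⟩ := ht.exists_fin List.mem_cons_self hN'
    rw [hl, matrixCells_apply]
    refine hu t j l (fun x hx => ?_) (fun B hB => ?_) ((ht.idx 10 (by decide)).trans hs₁k) hl
    · simp only [List.mem_cons, List.not_mem_nil, or_false, not_or] at hx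
      exact (ht.idx x (by simp [hx])).trans (hs₁.idx x (by simp [sumInto, keepsIdx, hx]))
    · exact (htmem B hB).trans (hs₁.mem B (by simp [sumInto, keepsMem, hB]))
  · simp [hs₁k, Finset.sum_range]
  · rintro i _ ⟨rfl, rfl⟩
    simp [hs₁k]

/-- The vector becomes the image of the basis row in register `12` under the step for the letter in
register `13`. -/
def multiply : Program :=
  rowSums arrVec (.cell arrBasis (.reg 12) (.reg 11) *
    .cell arrAut (.reg 11 + .reg regDim * .reg 13) (.reg 10))

theorem runs_multiply {r : Fin N} {a : Fin σ} (hN : s.idx regDim = N) (hA : Stores A arrAut s.mem)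
    (hr : s.idx 12 = r) (ha : s.idx 13 = a) :
    Runs multiply s (N * N) fun μ =>
      vectorOf (μ arrVec) = (matrixOf (s.mem arrBasis)).row r ᵥ* A.step a := by
  refine runs_rowSums (M := Matrix.of fun j l => matrixOf (s.mem arrBasis) r l * A.step a l j) hN
    r.pos fun t j l ht htmem hj hl => ?_
  simp [hj, hl, ht 12 (by decide), ht 13 (by decide), ht regDim (by decide), hr, ha, hN,
    htmem arrBasis (by decide), htmem arrAut (by decide), hA.step, matrixOf]

theorem runs_multiply_insert {B : Matrix (Fin N) (Fin N) ℝ} {r : Fin N} {a : Fin σ}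
    (hN : s.idx regDim = N) (hA : Stores A arrAut s.mem) (hr : s.idx 12 = r) (ha : s.idx 13 = a)
    (hbasis : matrixOf (s.mem arrBasis) = B) (hB : IsDiagonalEchelon B) :
    Runs (multiply ;; insert) s (N * N) fun μ =>
      ∃ v, Elimination B (B.row r ᵥ* A.step a) N (matrixOf (μ arrBasis)) v :=
  (runs_multiply hN hA hr ha).seq fun _ hs' hvec =>
    runs_insert ((hs'.idx _ (by decide)).trans hN) r.pos
      ((congrArg matrixOf (hs'.mem _ (by decide))).trans hbasis) (hbasis ▸ hvec) hB

/-- One round of adjoining the images of all basis rows to the basis. -/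
def sweep : Program := forLt 12 regDim (forLt 13 0 (multiply ;; insert))

theorem runs_sweep {B : Matrix (Fin N) (Fin N) ℝ} (hσ : s.idx 0 = σ) (hσ₁ : 1 ≤ σ)
    (hN : s.idx regDim = N) (hN₁ : 1 ≤ N) (hA : Stores A arrAut s.mem)
    (hbasis : matrixOf (s.mem arrBasis) = B) (hB : IsDiagonalEchelon B)
    (hle : rowSpan B ≤ A.reachable) :
    Runs sweep s (N * (σ * (N * N))) fun μ =>
      AdjoinImages A B (fun _ _ => True) (matrixOf (μ arrBasis)) := by
  have hNN : 1 ≤ N * N := Nat.mul_pos hN₁ hN₁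
  refine (Runs.forLt (fun k μ => AdjoinImages A B (fun r _ => r < k) (matrixOf (μ arrBasis)))
    hN (by decide) (by decide) (by decide) hN₁ (Nat.mul_pos hσ₁ hNN)
    (by rw [hbasis]; exact .start hB hle (by simp)) fun k hk s₁ hs₁ hs₁k hInv₁ => ?_).mono le_rfl
      fun μ hμ => hμ.of_imp fun r _ _ => r.isLt
  refine (Runs.forLt (fun l μ => AdjoinImages A B (fun r a => r < k ∨ r = k ∧ a < l)
    (matrixOf (μ arrBasis))) ((hs₁.idx _ (by decide)).trans hσ) (by decide) (by decide) (by decide)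
    hσ₁ hNN (hInv₁.of_imp (by simp)) fun l hl s₂ hs₂ hs₂l hInv₂ => ?_).mono le_rfl
      fun μ hμ => hμ.of_imp fun r a hr => by have := a.isLt; omega
  have hmem : ∀ B, (multiply ;; insert).keepsMem B → s₂.mem B = s.mem B := fun B hB =>
    (hs₂.mem B (by simpa using hB)).trans (hs₁.mem B (by simpa using hB))
  refine (runs_multiply_insert (r := ⟨k, hk⟩) (a := ⟨l, hl⟩)
    ((hs₂.idx _ (by decide)).trans ((hs₁.idx _ (by decide)).trans hN))
    (hA.congr (hmem _ (by decide)) (hmem _ (by decide)) (hmem _ (by decide)))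
    ((hs₂.idx _ (by decide)).trans hs₁k) hs₂l rfl hInv₂.isDiagonalEchelon).mono le_rfl
      fun μ ⟨v, hE⟩ => hInv₂.adjoin hB hE fun r a hra => ?_
  simp only [Fin.ext_iff]
  omega

/-- The basis, initially zero, becomes a basis of the reachable space. -/
def computeReachable : Program :=
  fill [(11, regDim)] arrVec 0 (.reg 11) (.cell (arrAut + 1) 0 (.reg 11)) ;; insert ;;
  forLt 14 regDim sweep

theorem runs_computeReachable (hσ : s.idx 0 = σ) (hσ₁ : 1 ≤ σ) (hN : s.idx regDim = N)
    (hN₁ : 1 ≤ N) (hA : Stores A arrAut s.mem)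
    (hbasis : matrixOf (s.mem arrBasis) = (0 : Matrix (Fin N) (Fin N) ℝ)) :
    Runs computeReachable s (N * (N * (σ * (N * N)))) fun μ =>
      rowSpan (matrixOf (μ arrBasis)) = A.reachable := by
  have hNN : 1 ≤ N * N := Nat.mul_pos hN₁ hN₁
  have hσNN : 1 ≤ N * (σ * (N * N)) := Nat.mul_pos hN₁ (Nat.mul_pos hσ₁ hNN)
  have hcost : N * N ≤ N * (N * (σ * (N * N))) := by
    rw [← mul_assoc N N]
    exact Nat.le_mul_of_pos_right _ (Nat.mul_pos hσ₁ hNN)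
  let Inv (r : ℕ) (μ : Memory) : Prop :=
    IsDiagonalEchelon (matrixOf (N := N) (μ arrBasis)) ∧
      A.ReachableApprox r (rowSpan (matrixOf (μ arrBasis)))
  refine Runs.seq ((runs_fill_vector (v := A.init) (by decide) hN hN₁ ?_).mono
    ((Nat.le_mul_of_pos_right _ hN₁).trans hcost) fun _ => id) fun s₁ hs₁ hvec => ?_
  · intro t l _ htmem hl
    simp [hl, htmem (arrAut + 1) (by decide), hA.init]
  refine Runs.seq (Q := Inv 0) ((runs_insert ((hs₁.idx _ (by decide)).trans hN) hN₁
    ((congrArg matrixOf (hs₁.mem _ (by decide))).trans hbasis) hvec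
    isDiagonalEchelon_zero).mono hcost
    fun μ ⟨v, hE⟩ => ⟨hE.isDiagonalEchelon, hE.reachableApprox_zero⟩) fun s₂ hs₂ hInv => ?_
  refine (Runs.forLt Inv ((hs₂.idx _ (by decide)).trans ((hs₁.idx _ (by decide)).trans hN))
    (by decide) (by decide) (by decide) hN₁ hσNN hInv fun r _ s₃ hs₃ _ hInv₃ => ?_).mono le_rfl
      fun μ hμ => hμ.2.eq_reachable (by simp)
  have hs : computeReachable.Frame s s₃ := hs₁.seq (hs₂.seq hs₃)
  refine (runs_sweep ((hs.idx _ (by decide)).trans hσ) hσ₁ ((hs.idx _ (by decide)).trans hN) hN₁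
    (hA.congr (hs.mem _ (by decide)) (hs.mem _ (by decide)) (hs.mem _ (by decide))) rfl hInv₃.1
    hInv₃.2.le).mono le_rfl fun μ hμ =>
      ⟨hμ.isDiagonalEchelon, hμ.reachableApprox_succ hInv₃.2⟩

/-- Decides whether all weights of the stored automaton vanish, by computing the sum of the squares
of the products of the basis rows with the final vector. -/
def testZero : Program :=
  computeReachable ;;
  rowSums arrDots (.cell arrBasis (.reg 10) (.reg 11) * .cell (arrAut + 2) 0 (.reg 11)) ;;
  sumInto arrNorm 0 11 regDim (.cell arrDots 0 (.reg 11) * .cell arrDots 0 (.reg 11))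

theorem runs_sumSq {v : Fin N → ℝ} (hN : s.idx regDim = N) (hN₁ : 1 ≤ N)
    (hv : vectorOf (s.mem arrDots) = v) :
    Runs (sumInto arrNorm 0 11 regDim (.cell arrDots 0 (.reg 11) * .cell arrDots 0 (.reg 11))) s N
      fun μ => μ arrNorm 0 0 = v ⬝ᵥ v := by
  subst hv
  refine Runs.mono (Fills.sumInto
      (Φ := fun _ _ => vectorOf (s.mem arrDots) ⬝ᵥ vectorOf (s.mem arrDots))
      (g := fun l => s.mem arrDots 0 l * s.mem arrDots 0 l) hN (by decide) hN₁ (fun _ _ => rfl)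
      (fun t _ htmem => ?_) ?_)
    le_rfl fun μ hμ => hμ 0 0 (.inl ⟨rfl, rfl⟩)
  · simp [htmem arrDots (by decide)]
  · rw [Finset.sum_range]
    rfl

theorem runs_testZero (hσ : s.idx 0 = σ) (hσ₁ : 1 ≤ σ) (hN : s.idx regDim = N)
    (hN₁ : 1 ≤ N) (hA : Stores A arrAut s.mem)
    (hbasis : matrixOf (s.mem arrBasis) = (0 : Matrix (Fin N) (Fin N) ℝ)) :
    Runs testZero s (N * (N * (σ * (N * N)))) fun μ => μ arrNorm 0 0 = 0 ↔ A.weight = 0 := by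
  have hNN : N * N ≤ N * (N * (σ * (N * N))) := by
    rw [← mul_assoc N N]
    exact Nat.le_mul_of_pos_right _ (Nat.mul_pos hσ₁ (Nat.mul_pos hN₁ hN₁))
  refine Runs.seq (runs_computeReachable hσ hσ₁ hN hN₁ hA hbasis) fun s₁ hs₁ hspan => ?_
  have hN₁' : s₁.idx regDim = N := (hs₁.idx _ (by decide)).trans hN
  have hfinal := hA.final
  rw [← hs₁.mem (arrAut + 2) (by decide)] at hfinal
  refine Runs.seq ((runs_rowSums
      (M := Matrix.of fun r l => matrixOf (s₁.mem arrBasis) r l * A.final l)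
      hN₁' hN₁ fun t r l _ htmem hr hl => ?_).mono hNN fun _ => id) fun s₂ hs₂ hdots =>
    (runs_sumSq ((hs₂.idx _ (by decide)).trans hN₁') hN₁ hdots).mono
      ((Nat.le_mul_of_pos_left _ hN₁).trans hNN) fun μ hμ => ?_
  · simp [hr, hl, htmem arrBasis (by decide), htmem (arrAut + 2) (by decide), hfinal, matrixOf]
  · rw [hμ, dotProduct_self_eq_zero, A.weight_eq_zero_iff_mulVec hspan]
    rfl

end WeightedAutomaton

/-- The step matrices of an automaton below each other, as the content of an array. -/
def stepCells {σ N : ℕ} (A : WeightedAutomaton (Fin σ) (Fin N) ℝ) : ℕ → ℕ → ℝ :=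
  matrixCells fun p : Fin (σ * N) =>
    A.step (finProdFinEquiv.symm p).1 (finProdFinEquiv.symm p).2

theorem stepCells_apply {σ N : ℕ} (A : WeightedAutomaton (Fin σ) (Fin N) ℝ) (a : Fin σ)
    (i j : Fin N) : stepCells A (i + N * a) j = A.step a i j := by
  refine (matrixCells_apply _ (finProdFinEquiv (a, i)) j).trans ?_
  rw [Equiv.symm_apply_apply]

theorem Runs.stores {σ N : ℕ} {A : WeightedAutomaton (Fin σ) (Fin N) ℝ} {P R T : Program}
    {s : State} {m b : ℕ}
    (hstep : Runs P s m fun μ => ∀ (a : Fin σ) (i j : Fin N), μ b (i + N * a) j = A.step a i j)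
    (hinit : ∀ s', P.Frame s s' → Runs R s' m fun μ => vectorOf (μ (b + 1)) = A.init)
    (hfinal : ∀ s', (P.seq R).Frame s s' → Runs T s' m fun μ => vectorOf (μ (b + 2)) = A.final)
    (hR : R.keepsMem b) (hT : T.keepsMem b) (hT' : T.keepsMem (b + 1)) :
    Runs (P ;; R ;; T) s m (Stores A b) := by
  refine hstep.seq fun s₁ hs₁ hstep₁ => (hinit s₁ hs₁).seq fun s₂ hs₂ hinit₂ =>
    (hfinal s₂ (hs₁.seq hs₂)).and_frame.mono le_rfl fun μ ⟨hfinal₃, hframe⟩ => ⟨?_, ?_, ?_⟩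
  · rwa [hframe b hT, hs₂.mem b hR]
  · rw [hframe (b + 1) hT']
    exact congrFun hinit₂
  · exact congrFun hfinal₃

/-- Stores step matrices whose size is in the register `d` as diagonal blocks, starting from the
row and column `o`, of step matrices whose size is in the register `D`. -/
def fillBlocks (D d : ℕ) (o : IExpr) (A : ℕ) (u : RExpr) : Program :=
  fill [(13, 0), (10, d), (11, d)] A (o + .reg 10 + .reg D * .reg 13) (o + .reg 11) u

theorem Fills.fillBlocks {σ n N D d A : ℕ} {o : IExpr} {u : RExpr} {s : State}
    {B : WeightedAutomaton (Fin σ) (Fin N) ℝ} {ι : Fin n → Fin N}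
    (hd : d ∉ [13, 10, 11]) (hD : D ∉ [13, 10, 11]) (hσ : s.idx 0 = σ) (hσ₁ : 1 ≤ σ)
    (hN : s.idx D = N) (hn : s.idx d = n) (hn₁ : 1 ≤ n)
    (ho : ∀ t i, Counts [(13, 0), (10, d), (11, d)] s t → o.eval t + i = ι i)
    (hu : ∀ t (a : Fin σ) (i j : Fin n), (∀ x ∉ [13, 10, 11], t.idx x = s.idx x) →
      (∀ B ≠ A, t.mem B = s.mem B) → t.idx 13 = a.val → t.idx 10 = i.val → t.idx 11 = j.val →
      u.Defined t ∧ u.eval t = B.step a (ι i) (ι j)) :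
    Fills (fillBlocks D d o A u) s (σ * (n * n)) A (stepCells B)
      fun i j => ∃ a p q, i = (ι p + N * (a : Fin σ) : ℕ) ∧ j = ι q := by
  refine (Fills.fill (by simp) (by simpa using hd) (by simp [hσ, hσ₁, hn, hn₁])
    fun t ht htmem => ?_).mono (by simp [hσ, hn]) ?_
  · obtain ⟨a, ha⟩ := ht.exists_fin (x := 13) (by simp) hσ
    obtain ⟨i, hi⟩ := ht.exists_fin (x := 10) (by simp) hn
    obtain ⟨j, hj⟩ := ht.exists_fin (x := 11) (by simp) hn
    simp only [IExpr.eval_add, IExpr.eval_mul, IExpr.eval_reg, ha, hi, hj, ho t _ ht,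
      (ht.idx D hD).trans hN, stepCells_apply]
    exact hu t a i j ht.idx htmem ha hi hj
  · rintro _ _ ⟨a, p, q, rfl, rfl⟩
    have ht : Counts [(13, 0), (10, d), (11, d)] s (((s.setIdx 13 a).setIdx 10 p).setIdx 11 q) :=
      ⟨by simp +contextual [State.setIdx], by simp [State.setIdx, hσ, hn]⟩
    refine ⟨_, ht, ?_, ?_⟩
    · simp only [IExpr.eval_add, IExpr.eval_mul, IExpr.eval_reg, (ht.idx D hD).trans hN,
        ← ho _ p ht]
      simp [State.setIdx]
    · simp [← ho _ q ht, State.setIdx]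

section Difference

variable {m n : ℕ} {s : State}

/-- Row `0` of the array `A` becomes the concatenation of two vectors with the entries `u` and
`v`. -/
def fillAppend (A : ℕ) (u v : RExpr) : Program :=
  fill [(11, regDimX)] A 0 (.reg 11) u ;;
  fill [(11, regDimY)] A 0 (.reg regDimX + .reg 11) v

theorem runs_fillAppend {A : ℕ} {u v : RExpr} {z : Fin (m + n) → ℝ}
    (hm : s.idx regDimX = m) (hn : s.idx regDimY = n) (hm₁ : 1 ≤ m) (hn₁ : 1 ≤ n)
    (hu : ∀ t (i : Fin m), (∀ B ≠ A, t.mem B = s.mem B) → t.idx 11 = i.val →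
      u.Defined t ∧ u.eval t = z (Fin.castAdd n i))
    (hv : ∀ t (j : Fin n), (∀ B ≠ A, t.mem B = s.mem B) → t.idx 11 = j.val →
      v.Defined t ∧ v.eval t = z (Fin.natAdd m j)) :
    Runs (fillAppend A u v) s (m + n) fun μ => vectorOf (μ A) = z := by
  have hX (i : Fin m) := vectorCells_apply z (Fin.castAdd n i)
  have hY (j : Fin n) := vectorCells_apply z (Fin.natAdd m j)
  simp only [Fin.val_castAdd, Fin.val_natAdd] at hX hY
  refine Runs.mono (Fills.seq (S := fun i j => i = 0 ∧ ∃ k : Fin m, j = k)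
    (S' := fun i j => i = 0 ∧ ∃ k : Fin n, j = m + k) (Φ := vectorCells z)
    ((Fills.fill (by simp) (by simp) (by simp [hm, hm₁]) fun t ht htmem => ?_).mono
      (by simp [hm]) ?_) fun s₁ hs₁ => ?_)
    le_rfl fun μ hμ => funext fun l => (hμ 0 l (.inl ?_)).trans (vectorCells_apply z l)
  · obtain ⟨i, hi⟩ := ht.exists_fin List.mem_cons_self hm
    simpa [hi, hX] using hu t i htmem hi
  · rintro _ _ ⟨rfl, k, rfl⟩
    exact ⟨s.setIdx 11 k, ⟨by simp +contextual [State.setIdx],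
        by simp [State.setIdx, hm]⟩, by simp [State.setIdx], by simp [State.setIdx]⟩
  · have hm' : s₁.idx regDimX = m := (hs₁.idx _ (by rfl)).trans hm
    have hn' : s₁.idx regDimY = n := (hs₁.idx _ (by rfl)).trans hn
    refine (Fills.fill (by simp) (by simp) (by simp [hn', hn₁]) fun t ht htmem => ?_).mono
      (by simp [hn']) ?_
    · obtain ⟨j, hj⟩ := ht.exists_fin List.mem_cons_self hn'
      simpa [hj, hY, ht.idx regDimX (by decide), hm'] using
        hv t j (fun B hB => (htmem B hB).trans (hs₁.mem B (keepsMem_fill hB))) hj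
    · rintro _ _ ⟨rfl, k, rfl⟩
      exact ⟨s₁.setIdx 11 k, ⟨by simp +contextual [State.setIdx],
        by simp [State.setIdx, hn']⟩, by simp [State.setIdx], by simp [State.setIdx, hm']⟩
  · refine Fin.addCases (fun i => .inl ⟨rfl, i, rfl⟩) (fun j => .inr ⟨rfl, j, rfl⟩) l

/-- Stores the step matrices of the difference of the two automata, except for the zeros. -/
def fillDifferenceSteps : Program :=
  fillBlocks regDim regDimX 0 arrAut (.cell arrX (.reg 10 + .reg regDimX * .reg 13) (.reg 11)) ;;
  fillBlocks regDim regDimY (.reg regDimX) arrAut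
    (.cell arrY (.reg 10 + .reg regDimY * .reg 13) (.reg 11))

/-- Stores the difference of the two automata, where the array of its step matrices is zero
before. -/
def fillDifference : Program :=
  fillDifferenceSteps ;;
  fillAppend (arrAut + 1) (.cell (arrX + 1) 0 (.reg 11)) (.cell (arrY + 1) 0 (.reg 11)) ;;
  fillAppend (arrAut + 2) (.cell (arrX + 2) 0 (.reg 11)) (0 - .cell (arrY + 2) 0 (.reg 11))

variable {σ : ℕ} {A : WeightedAutomaton (Fin σ) (Fin m) ℝ}
  {B : WeightedAutomaton (Fin σ) (Fin n) ℝ}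

theorem runs_fillDifferenceSteps (hσ : s.idx 0 = σ) (hσ₁ : 1 ≤ σ)
    (hm : s.idx regDimX = m) (hn : s.idx regDimY = n) (hN : s.idx regDim = m + n) (hm₁ : 1 ≤ m)
    (hn₁ : 1 ≤ n) (hA : Stores A arrX s.mem) (hB : Stores B arrY s.mem)
    (hzero : s.mem arrAut = fun _ _ => 0) :
    Runs fillDifferenceSteps s (σ * ((m + n) * (m + n))) fun μ =>
      ∀ (a : Fin σ) (i j : Fin (m + n)), μ arrAut (i + (m + n) * a) j =
        ((A.difference B).reindex finSumFinEquiv).step a i j := by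
  refine Runs.mono (Fills.seq ((Fills.fillBlocks (ι := Fin.castAdd n)
      (B := (A.difference B).reindex finSumFinEquiv) (by decide) (by decide) hσ hσ₁ hN hm hm₁
      (fun t i _ => zero_add _) fun t a i j ht htmem ha hi hj => ?_).mono
        (by gcongr <;> omega) fun _ _ => id)
    fun s₁ hs₁ => (Fills.fillBlocks (ι := Fin.natAdd m) (by decide) (by decide)
      ((hs₁.idx _ (by decide)).trans hσ) hσ₁ ((hs₁.idx _ (by decide)).trans hN)
      ((hs₁.idx _ (by decide)).trans hn) hn₁ (fun t i ht => ?_)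
      fun t a i j ht htmem ha hi hj => ?_).mono (by gcongr <;> omega) fun _ _ => id)
    le_rfl fun μ hμ a i j => (hμ _ _ ?_).trans (stepCells_apply _ a i j)
  · simp [ha, hi, hj, ht regDimX (by decide), hm, htmem arrX (by decide), hA.step,
      WeightedAutomaton.reindex, WeightedAutomaton.difference]
  · simp [ht.idx regDimX (by decide), (hs₁.idx regDimX (by decide)), hm]
  · simp [ha, hi, hj, ht regDimY (by decide), (hs₁.idx regDimY (by decide)), hn,
      htmem arrY (by decide), hs₁.mem arrY (by decide), hB.step,
      WeightedAutomaton.reindex, WeightedAutomaton.difference]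
  · rw [stepCells_apply, hzero]
    refine Fin.addCases (fun i => ?_) (fun i => ?_) i <;>
      refine Fin.addCases (fun j => ?_) (fun j => ?_) j
    · exact .inl (.inl ⟨a, i, j, rfl, rfl⟩)
    · exact .inr (by simp [WeightedAutomaton.reindex, WeightedAutomaton.difference])
    · exact .inr (by simp [WeightedAutomaton.reindex, WeightedAutomaton.difference])
    · exact .inl (.inr ⟨a, i, j, rfl, rfl⟩)

theorem runs_fillDifference (hσ : s.idx 0 = σ) (hσ₁ : 1 ≤ σ)
    (hm : s.idx regDimX = m) (hn : s.idx regDimY = n) (hN : s.idx regDim = m + n) (hm₁ : 1 ≤ m)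
    (hn₁ : 1 ≤ n) (hA : Stores A arrX s.mem) (hB : Stores B arrY s.mem)
    (hzero : s.mem arrAut = fun _ _ => 0) :
    Runs fillDifference s (σ * ((m + n) * (m + n)))
      (Stores ((A.difference B).reindex finSumFinEquiv) arrAut) := by
  have hcost : m + n ≤ σ * ((m + n) * (m + n)) :=
    (Nat.le_mul_of_pos_left _ (by omega)).trans (Nat.le_mul_of_pos_left _ hσ₁)
  refine Runs.stores (runs_fillDifferenceSteps hσ hσ₁ hm hn hN hm₁ hn₁ hA hB hzero)
    (fun s₁ hs₁ => (runs_fillAppend ((hs₁.idx _ (by decide)).trans hm)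
      ((hs₁.idx _ (by decide)).trans hn) hm₁ hn₁ (fun t i ht hi => ?_) fun t j ht hj => ?_).mono
      hcost fun _ => id)
    (fun s₁ hs₁ => (runs_fillAppend ((hs₁.idx _ (by decide)).trans hm)
      ((hs₁.idx _ (by decide)).trans hn) hm₁ hn₁ (fun t i ht hi => ?_) fun t j ht hj => ?_).mono
      hcost fun _ => id) (by decide) (by decide) (by decide)
  · simp [hi, ht (arrX + 1) (by decide), hs₁.mem (arrX + 1) (by decide), hA.init,
      WeightedAutomaton.reindex, WeightedAutomaton.difference]
  · simp [hj, ht (arrY + 1) (by decide), hs₁.mem (arrY + 1) (by decide), hB.init,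
      WeightedAutomaton.reindex, WeightedAutomaton.difference]
  · simp [hi, ht (arrX + 2) (by decide), hs₁.mem (arrX + 2) (by decide), hA.final,
      WeightedAutomaton.reindex, WeightedAutomaton.difference]
  · simp [hj, ht (arrY + 2) (by decide), hs₁.mem (arrY + 2) (by decide), hB.final,
      WeightedAutomaton.reindex, WeightedAutomaton.difference]

end Difference

section Equivalence

variable {σ m n : ℕ} {A : WeightedAutomaton (Fin σ) (Fin m) ℝ}
  {B : WeightedAutomaton (Fin σ) (Fin n) ℝ} {s : State}

/-- Decides whether the two stored automata have the same weights. -/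
def testEquiv : Program := fillDifference ;; testZero

theorem runs_testEquiv (hσ : s.idx 0 = σ) (hσ₁ : 1 ≤ σ) (hm : s.idx regDimX = m)
    (hn : s.idx regDimY = n) (hN : s.idx regDim = m + n) (hm₁ : 1 ≤ m) (hn₁ : 1 ≤ n)
    (hA : Stores A arrX s.mem) (hB : Stores B arrY s.mem) (haut : s.mem arrAut = fun _ _ => 0)
    (hbasis : s.mem arrBasis = fun _ _ => 0) :
    Runs testEquiv s (σ * (m + n) ^ 4) fun μ => μ arrNorm 0 0 = 0 ↔ A.weight = B.weight := by
  have hN₁ : 1 ≤ m + n := hm₁.trans (Nat.le_add_right m n)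
  have hcost : σ * ((m + n) * (m + n)) ≤ σ * (m + n) ^ 4 :=
    Nat.mul_le_mul_left _ ((pow_two (m + n)).ge.trans (Nat.pow_le_pow_right hN₁ (by decide)))
  refine Runs.seq ((runs_fillDifference hσ hσ₁ hm hn hN hm₁ hn₁ hA hB haut).mono hcost
    fun _ => id) fun s₁ hs₁ hdiff => ?_
  refine (runs_testZero ((hs₁.idx _ (by decide)).trans hσ) hσ₁ ((hs₁.idx _ (by decide)).trans hN)
    hN₁ hdiff ?_).mono (Eq.le (by ring)) fun μ hμ => ?_
  · rw [hs₁.mem _ (by decide), hbasis]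
    rfl
  · rw [hμ, WeightedAutomaton.weight_reindex, WeightedAutomaton.weight_difference_eq_zero_iff]

/-- Writes the verdict to the register `0`: whether the number computed by `testZero` is zero. -/
def answer : Program := .ifZero (.cell arrNorm 0 0) (.setIdx 0 1) (.setIdx 0 0)

theorem Runs.decidesWithin {P : Program} {c T : ℕ} {φ : Prop}
    (h : Runs P s c fun μ => μ arrNorm 0 0 = 0 ↔ φ) (hc : 1 ≤ c)
    (hT : (P.seq answer).size * c ≤ T) : DecidesWithin (P ;; answer) s T φ := by
  obtain ⟨t, s', hexec, ht, hφ⟩ := h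
  have hcost : t + answer.size ≤ T := calc
    t + answer.size ≤ c * P.size + c * answer.size :=
      Nat.add_le_add ht (Nat.le_mul_of_pos_left _ hc)
    _ = (P ;; answer).size * c := by rw [← Nat.mul_add, Nat.mul_comm]; rfl
    _ ≤ T := hT
  by_cases hzero : s'.mem arrNorm 0 0 = 0
  · exact ⟨_, _, hexec.seq (.ifZero_true trivial hzero (.setIdx s' 0 1)),
      (Nat.add_le_add_left (by decide) t).trans hcost, fun _ => rfl,
      fun hnot => absurd (hφ.mp hzero) hnot⟩
  · exact ⟨_, _, hexec.seq (.ifZero_false trivial hzero (.setIdx s' 0 0)),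
      (Nat.add_le_add_left (by decide) t).trans hcost,
      fun hφ' => absurd (hφ.mpr hφ') hzero, fun _ => rfl⟩

theorem runs_load_testEquiv {P R : Program} (hP : Runs P s (σ * (m + n) ^ 4) (Stores A arrX))
    (hR : ∀ s', P.Frame s s' → Runs R s' (σ * (m + n) ^ 4) (Stores B arrY))
    (hkeepsIdx : ∀ x ∈ [0, regDimX, regDimY, regDim], (P.seq R).keepsIdx x)
    (hkeepsMem : ∀ A ∈ [arrAut, arrBasis], (P.seq R).keepsMem A)
    (hRX : ∀ A ∈ [arrX, arrX + 1, arrX + 2], R.keepsMem A)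
    (hσ : s.idx 0 = σ) (hσ₁ : 1 ≤ σ) (hm : s.idx regDimX = m)
    (hn : s.idx regDimY = n) (hN : s.idx regDim = m + n) (hm₁ : 1 ≤ m) (hn₁ : 1 ≤ n)
    (haut : s.mem arrAut = fun _ _ => 0) (hbasis : s.mem arrBasis = fun _ _ => 0) :
    Runs (P ;; R ;; testEquiv) s (σ * (m + n) ^ 4) fun μ =>
      μ arrNorm 0 0 = 0 ↔ A.weight = B.weight := by
  refine Runs.seq hP fun s₁ hs₁ hA => Runs.seq (hR s₁ hs₁) fun s₂ hs₂ hB => ?_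
  have hs : (P ;; R).Frame s s₂ := hs₁.seq hs₂
  refine runs_testEquiv ?_ hσ₁ ?_ ?_ ?_ hm₁ hn₁ ?_ hB ?_ ?_
  · rwa [hs.idx _ (hkeepsIdx _ (by decide))]
  · rwa [hs.idx _ (hkeepsIdx _ (by decide))]
  · rwa [hs.idx _ (hkeepsIdx _ (by decide))]
  · rwa [hs.idx _ (hkeepsIdx _ (by decide))]
  · exact hA.congr (hs₂.mem _ (hRX _ (by decide))) (hs₂.mem _ (hRX _ (by decide)))
      (hs₂.mem _ (hRX _ (by decide)))
  · rwa [hs.mem _ (hkeepsMem _ (by decide))]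
  · rwa [hs.mem _ (hkeepsMem _ (by decide))]

end Equivalence

section HMM

variable {σ m n : ℕ}

/-- Stores the automaton of a hidden Markov model, given in the arrays from number `c` on, in the
arrays from number `b` on; the number of hidden states is in the register `d`. -/
def loadHMM (d c b : ℕ) : Program :=
  fillBlocks d d 0 b
    (.cell (c + 2) (.reg 10) (.reg 13) * .cell (c + 1) (.reg 10) (.reg 11)) ;;
  fill [(11, d)] (b + 1) 0 (.reg 11) (.cell c 0 (.reg 11)) ;;
  fill [(11, d)] (b + 2) 0 (.reg 11) 1

theorem runs_loadHMM {M : HMM σ n} {s : State} {d c b : ℕ} (hd : d ∉ [13, 10, 11])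
    (hcb : c + 2 < b) (hσ : s.idx 0 = σ) (hn : s.idx d = n) (hinit : s.mem c = vectorCells M.init)
    (htrans : s.mem (c + 1) = matrixCells M.trans) (hemit : s.mem (c + 2) = matrixCells M.emit) :
    Runs (loadHMM d c b) s (σ * (n * n)) (Stores M.toAutomaton b) := by
  have hσ₁ := M.card_alphabet_pos
  have hn₁ := M.card_states_pos
  have hcost : n ≤ σ * (n * n) :=
    (Nat.le_mul_of_pos_left _ hn₁).trans (Nat.le_mul_of_pos_left _ hσ₁)
  have hd₁ : d ≠ 11 := fun h => hd (by simp [h])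
  have hmem {A B : ℕ} {u : RExpr} (h : A ≠ B) : (fill [(11, d)] B 0 (.reg 11) u).keepsMem A :=
    keepsMem_fill h
  refine Runs.stores (Runs.mono (Fills.fillBlocks (ι := id) (B := M.toAutomaton) hd hd hσ hσ₁ hn hn
      hn₁ (fun _ _ _ => zero_add _) fun t a i j _ htmem ha hi hj => ?_)
      le_rfl fun μ hμ a i j =>
        (hμ _ _ (.inl ⟨a, i, j, rfl, rfl⟩)).trans (stepCells_apply _ a i j))
    (fun s₁ hs₁ => (runs_fill_vector hd₁ ((hs₁.idx d ?_).trans hn) hn₁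
      fun t l _ htmem hl => ?_).mono hcost fun _ => id)
    (fun s₁ hs₁ => (runs_fill_vector hd₁ ((hs₁.idx d ?_).trans hn) hn₁
      fun t l _ _ _ => ?_).mono hcost fun _ => id)
    (hmem (by omega)) (hmem (by omega)) (hmem (by omega))
  · simp [ha, hi, hj, htmem (c + 1) (by omega), htmem (c + 2) (by omega), htrans, hemit,
      matrixCells_apply M.emit i a, matrixCells_apply M.trans i j, HMM.toAutomaton]
  · exact keepsIdx_fill (by simpa using hd)
  · have hframe := hs₁.mem c (keepsMem_fill (by omega))
    simp [hl, htmem c (by omega), hframe, hinit, HMM.toAutomaton]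
  · simp only [keepsIdx, Bool.and_eq_true]
    exact ⟨keepsIdx_fill (by simpa using hd), keepsIdx_fill (by simpa using hd₁)⟩
  · simp [HMM.toAutomaton]

/-- Decides equivalence of two hidden Markov models in the input format of `hmmInput`. -/
def decideHMM : Program :=
  (setIdx regDimX (.reg 1) ;; setIdx regDimY (.reg 2) ;;
    setIdx regDim (.reg regDimX + .reg regDimY) ;;
    loadHMM regDimX 0 arrX ;; loadHMM regDimY 3 arrY ;; testEquiv) ;; answer

theorem decideHMM_decidesWithin (MX : HMM σ m) (MY : HMM σ n) :
    DecidesWithin decideHMM (hmmInput MX MY) (decideHMM.size * 2 ^ 4 * (σ * max m n ^ 4))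
      (MX.prob = MY.prob) := by
  have hσ₁ := MX.card_alphabet_pos
  have hm₁ := MX.card_states_pos
  have hn₁ := MY.card_states_pos
  have hpos : 1 ≤ σ * (m + n) ^ 4 := Nat.mul_pos hσ₁ (Nat.pow_pos (by omega))
  have hcost {k : ℕ} (hk : k ≤ m + n) : σ * (k * k) ≤ σ * (m + n) ^ 4 := by
    rw [← sq]
    exact Nat.mul_le_mul_left _ ((Nat.pow_le_pow_left hk 2).trans
      (Nat.pow_le_pow_right (by omega) (by decide)))
  rw [← MX.weight_toAutomaton, ← MY.weight_toAutomaton]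
  refine Runs.decidesWithin (.setIdx_seq hpos (.setIdx_seq hpos (.setIdx_seq hpos ?_))) hpos ?_
  · refine runs_load_testEquiv ((runs_loadHMM (by decide) (by decide) rfl rfl rfl rfl rfl).mono
        (hcost (Nat.le_add_right m n)) fun _ => id)
      (fun s hs => (runs_loadHMM (by decide) (by decide)
        (hs.idx 0 (by decide)) (hs.idx _ (by decide)) (hs.mem _ (by decide))
        (hs.mem _ (by decide)) (hs.mem _ (by decide))).mono
          (hcost (Nat.le_add_left n m)) fun _ => id)
      (by decide) (by decide) (by decide) rfl hσ₁ rfl rfl rfl hm₁ hn₁ rfl rfl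
  · calc decideHMM.size * (σ * (m + n) ^ 4)
        ≤ decideHMM.size * (σ * (2 * max m n) ^ 4) := by gcongr; omega
      _ = decideHMM.size * 2 ^ 4 * (σ * max m n ^ 4) := by ring

end HMM

section QRW

variable {σ K : ℕ} {Q : QRW σ K} {y c b : ℕ} {s : State}

/-- The state `s` provides the quantum random walk `Q`: its matrix and its wave function are in the
arrays from number `c` on, and the numbers of edges per vertex, of edges and of states of its
automaton are in the registers `y`, `y + 5` and `y + 2`. All these arrays and registers have numbers
below `10`. -/
structure Provides (Q : QRW σ K) (y c : ℕ) (s : State) : Prop where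
  reg_lt : y + 5 < 10
  array_lt : c + 3 < 10
  alphabet : s.idx 0 = σ
  degree : s.idx y = K
  edges : s.idx (y + 5) = σ * K
  dim : s.idx (y + 2) = σ * K * (σ * K) + σ * K * (σ * K)
  re_U : s.mem c = matrixCells fun i j => (Q.U (edge i) (edge j)).re
  im_U : s.mem (c + 1) = matrixCells fun i j => (Q.U (edge i) (edge j)).im
  re_ψ₀ : s.mem (c + 2) = vectorCells fun i => (Q.ψ₀ (edge i)).re
  im_ψ₀ : s.mem (c + 3) = vectorCells fun i => (Q.ψ₀ (edge i)).im

theorem Provides.congr {Q : QRW σ K} {y c : ℕ} {s t : State} (h : Provides Q y c s)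
    (hidx : ∀ x < 10, t.idx x = s.idx x) (hmem : ∀ A < 10, t.mem A = s.mem A) :
    Provides Q y c t := by
  have hy := h.reg_lt
  have hc := h.array_lt
  exact ⟨hy, hc, (hidx 0 (by omega)).trans h.alphabet, (hidx y (by omega)).trans h.degree,
    (hidx _ (by omega)).trans h.edges, (hidx _ (by omega)).trans h.dim,
    (hmem _ (by omega)).trans h.re_U, (hmem _ (by omega)).trans h.im_U,
    (hmem _ (by omega)).trans h.re_ψ₀, (hmem _ (by omega)).trans h.im_ψ₀⟩

theorem Provides.of_counts {Q : QRW σ K} {y c b : ℕ} {L : List (ℕ × ℕ)} {s t : State}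
    (h : Provides Q y c s) (hb : 10 ≤ b) (hL : ∀ p ∈ L, 10 ≤ p.1) (ht : Counts L s t)
    (htmem : ∀ B ≠ b, t.mem B = s.mem B) : Provides Q y c t := by
  refine h.congr (fun x hx => ht.idx x fun hxL => ?_) fun A hA => htmem A (by omega)
  obtain ⟨p, hp, rfl⟩ := List.mem_map.mp hxL
  exact absurd (hL p hp) (by omega)

theorem Provides.of_frame {Q : QRW σ K} {y c : ℕ} {s t : State} {P : Program}
    (h : Provides Q y c s) (hP : P.Frame s t) (hidx : ∀ x < 10, P.keepsIdx x)
    (hmem : ∀ A < 10, P.keepsMem A) : Provides Q y c t :=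
  h.congr (fun x hx => hP.idx x (hidx x hx)) fun A hA => hP.mem A (hmem A hA)

theorem edge_finProdFinEquiv (a : Fin σ) (x : Fin K) : edge (finProdFinEquiv (a, x)) = (a, x) :=
  Equiv.symm_apply_apply _ _

theorem matrixCells_edge {n : ℕ} (M : Fin σ × Fin K → Fin n → ℝ) (a : Fin σ) (x : Fin K)
    (j : Fin n) : matrixCells (fun i => M (edge i)) (x + K * a) j = M (a, x) j := by
  refine (matrixCells_apply _ (finProdFinEquiv (a, x)) j).trans ?_
  rw [edge_finProdFinEquiv]

/-- The real part of the product `U e' e * conj (U f' f)`, where `e` and `f` are the numbers in the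
registers `10` and `11`, and `e'` and `f'` are the edges `(a, x)` and `(a, x')` for the numbers
`a`, `x` and `x'` in the registers `13`, `14` and `15`. -/
def reProduct (y c : ℕ) : RExpr :=
  .cell c (.reg 14 + .reg y * .reg 13) (.reg 10) * .cell c (.reg 15 + .reg y * .reg 13) (.reg 11) +
    .cell (c + 1) (.reg 14 + .reg y * .reg 13) (.reg 10) *
      .cell (c + 1) (.reg 15 + .reg y * .reg 13) (.reg 11)

/-- The imaginary part of the product in `reProduct`. -/
def imProduct (y c : ℕ) : RExpr :=
  .cell (c + 1) (.reg 14 + .reg y * .reg 13) (.reg 10) *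
      .cell c (.reg 15 + .reg y * .reg 13) (.reg 11) -
    .cell c (.reg 14 + .reg y * .reg 13) (.reg 10) *
      .cell (c + 1) (.reg 15 + .reg y * .reg 13) (.reg 11)

theorem eval_products {Q : QRW σ K} {y c : ℕ} {t : State} (h : Provides Q y c t) {a : Fin σ}
    {x x' : Fin K} {e f : Fin (σ * K)} (ha : t.idx 13 = a) (hx : t.idx 14 = x) (hx' : t.idx 15 = x')
    (he : t.idx 10 = e) (hf : t.idx 11 = f) :
    let z := Q.densityAutomaton.step a (edge e, edge f)
      (edge (finProdFinEquiv (a, x)), edge (finProdFinEquiv (a, x')))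
    (reProduct y c).eval t = z.re ∧ (imProduct y c).eval t = z.im := by
  have hre (x : Fin K) (e : Fin (σ * K)) :=
    matrixCells_edge (fun p (j : Fin (σ * K)) => (Q.U p (edge j)).re) a x e
  have him (x : Fin K) (e : Fin (σ * K)) :=
    matrixCells_edge (fun p (j : Fin (σ * K)) => (Q.U p (edge j)).im) a x e
  constructor
  · simp [reProduct, ha, hx, hx', he, hf, h.degree, h.re_U, h.im_U, hre, him,
      edge_finProdFinEquiv, QRW.densityAutomaton]
  · simp [imProduct, ha, hx, hx', he, hf, h.degree, h.re_U, h.im_U, hre, him,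
      edge_finProdFinEquiv, QRW.densityAutomaton, sub_eq_neg_add]

/-- Stores a block of a step matrix of the automaton of a quantum random walk, between real or
imaginary parts of entries of density matrices: `o` and `o'` are the offsets of the row and the
column, and `u` is the entry. The columns are restricted to the pairs of edges that leave the
observed vertex. -/
def fillDensityBlock (y b : ℕ) (o o' : IExpr) (u : RExpr) : Program :=
  fill [(13, 0), (14, y), (15, y), (10, y + 5), (11, y + 5)] b
    (o + (.reg 11 + .reg (y + 5) * .reg 10) + .reg (y + 2) * .reg 13)
    (o' + (.reg 15 + .reg y * .reg 13 + .reg (y + 5) * (.reg 14 + .reg y * .reg 13))) u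

theorem keepsIdx_fillDensityBlock {x y b : ℕ} {o o' : IExpr} {u : RExpr} (hx : x < 10) :
    (fillDensityBlock y b o o' u).keepsIdx x :=
  keepsIdx_fill (by simp; omega)

theorem Fills.fillDensityBlock {Q : QRW σ K} {y c b : ℕ} {o o' : IExpr} {u : RExpr} {s : State}
    {p q : Fin (σ * K * (σ * K)) → Fin (σ * K * (σ * K) + σ * K * (σ * K))}
    (hQ : Provides Q y c s) (hb : 10 ≤ b)
    (ho : ∀ t i, Provides Q y c t → o.eval t + i = p i)
    (ho' : ∀ t i, Provides Q y c t → o'.eval t + i = q i)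
    (hu : ∀ t (a : Fin σ) (x x' : Fin K) (e f : Fin (σ * K)), Provides Q y c t →
      t.idx 13 = a.val → t.idx 14 = x.val → t.idx 15 = x'.val → t.idx 10 = e.val →
      t.idx 11 = f.val → u.Defined t ∧ u.eval t =
        Q.toAutomaton.step a (p (finProdFinEquiv (e, f)))
          (q (finProdFinEquiv (finProdFinEquiv (a, x), finProdFinEquiv (a, x'))))) :
    Fills (fillDensityBlock y b o o' u) s (σ * (K * (K * (σ * K * (σ * K))))) b
      (stepCells Q.toAutomaton) fun i j => ∃ (a : Fin σ) (x x' : Fin K) (l : Fin (σ * K * (σ * K))),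
        i = p l + (σ * K * (σ * K) + σ * K * (σ * K)) * a ∧
        j = q (finProdFinEquiv (finProdFinEquiv (a, x), finProdFinEquiv (a, x'))) := by
  have hk := Q.card_edges_pos
  have hy := hQ.reg_lt
  have hσ : 1 ≤ σ := Nat.pos_of_mul_pos_right hk
  have hK : 1 ≤ K := Nat.pos_of_mul_pos_left hk
  have hcounts {t : State}
      (ht : Counts [(13, 0), (14, y), (15, y), (10, y + 5), (11, y + 5)] s t) :=
    hQ.of_counts hb (by simp) ht
  refine (Fills.fill (by simp) (by simp; omega)
    (by simpa [hQ.alphabet, hQ.degree, hQ.edges, hσ, hK] using hk) fun t ht htmem => ?_).mono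
    (by simp [hQ.alphabet, hQ.degree, hQ.edges]) ?_
  · have hQt := hcounts ht htmem
    obtain ⟨a, ha⟩ := ht.exists_fin (x := 13) (by simp) hQ.alphabet
    obtain ⟨x, hx⟩ := ht.exists_fin (x := 14) (by simp) hQ.degree
    obtain ⟨x', hx'⟩ := ht.exists_fin (x := 15) (by simp) hQ.degree
    obtain ⟨e, he⟩ := ht.exists_fin (x := 10) (by simp) hQ.edges
    obtain ⟨f, hf⟩ := ht.exists_fin (x := 11) (by simp) hQ.edges
    have hrow := ho t (finProdFinEquiv (e, f)) hQt
    have hcol := ho' t (finProdFinEquiv (finProdFinEquiv (a, x), finProdFinEquiv (a, x'))) hQt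
    simp only [finProdFinEquiv_apply_val] at hrow hcol
    simp only [IExpr.eval_add, IExpr.eval_mul, IExpr.eval_reg, ha, hx, hx', he, hf, hrow, hcol,
      hQt.dim, hQt.degree, hQt.edges, stepCells_apply]
    exact hu t a x x' e f hQt ha hx hx' he hf
  · rintro _ _ ⟨a, x, x', l, rfl, rfl⟩
    obtain ⟨⟨e, f⟩, rfl⟩ := finProdFinEquiv.surjective l
    let t := ((((s.setIdx 13 a).setIdx 14 x).setIdx 15 x').setIdx 10 e).setIdx 11 f
    have ht : Counts [(13, 0), (14, y), (15, y), (10, y + 5), (11, y + 5)] s t :=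
      ⟨by simp +contextual [t, State.setIdx],
        by simp [t, State.setIdx, hQ.alphabet, hQ.degree, hQ.edges]⟩
    have hQt : Provides Q y c t := hcounts ht fun _ _ => rfl
    refine ⟨t, ht, ?_, ?_⟩
    · simp only [IExpr.eval_add, IExpr.eval_mul, IExpr.eval_reg, hQt.dim, hQt.edges,
        ← ho t _ hQt, finProdFinEquiv_apply_val]
      simp [t, State.setIdx]
    · simp only [IExpr.eval_add, IExpr.eval_mul, IExpr.eval_reg, hQt.degree, hQt.edges,
        ← ho' t _ hQt, finProdFinEquiv_apply_val]
      simp [t, State.setIdx]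

/-- Stores the step matrices of the automaton of a quantum random walk, except for the zeros, in the
array `b`. -/
def fillDensitySteps (y c b : ℕ) : Program :=
  fillDensityBlock y b 0 0 (reProduct y c) ;;
  fillDensityBlock y b 0 (.reg (y + 5) * .reg (y + 5)) (imProduct y c) ;;
  fillDensityBlock y b (.reg (y + 5) * .reg (y + 5)) 0 (0 - imProduct y c) ;;
  fillDensityBlock y b (.reg (y + 5) * .reg (y + 5)) (.reg (y + 5) * .reg (y + 5)) (reProduct y c)

theorem runs_fillDensitySteps (hQ : Provides Q y c s) (hb : 10 ≤ b)
    (hzero : s.mem b = fun _ _ => 0) :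
    Runs (fillDensitySteps y c b) s (σ * (K * (K * (σ * K * (σ * K))))) fun μ =>
      ∀ (a : Fin σ) (i j : Fin (σ * K * (σ * K) + σ * K * (σ * K))),
        μ b (i + (σ * K * (σ * K) + σ * K * (σ * K)) * a) j = Q.toAutomaton.step a i j := by
  have hframe {o o' u} {s t : State} (hQ : Provides Q y c s)
      (h : (fillDensityBlock y b o o' u).Frame s t) : Provides Q y c t :=
    hQ.of_frame h (fun _ => keepsIdx_fillDensityBlock) fun A hA => keepsMem_fill (by omega)
  have hre (t : State) (i : Fin (σ * K * (σ * K))) (_ : Provides Q y c t) :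
      (0 : IExpr).eval t + i = Fin.castAdd (σ * K * (σ * K)) i := zero_add _
  have him (t : State) (i : Fin (σ * K * (σ * K))) (ht : Provides Q y c t) :
      (.reg (y + 5) * .reg (y + 5) : IExpr).eval t + i = Fin.natAdd (σ * K * (σ * K)) i := by
    simp [-Fin.natAdd_eq_addNat, ht.edges]
  refine Runs.mono (Fills.seq (.fillDensityBlock hQ hb hre hre ?_) fun s₁ hs₁ =>
    Fills.seq (.fillDensityBlock (hframe hQ hs₁) hb hre him ?_) fun s₂ hs₂ =>
    Fills.seq (.fillDensityBlock (hframe (hframe hQ hs₁) hs₂) hb him hre ?_) fun s₃ hs₃ =>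
    .fillDensityBlock (hframe (hframe (hframe hQ hs₁) hs₂) hs₃) hb him him ?_) le_rfl
    fun μ hμ a i j => (hμ _ _ ?_).trans (stepCells_apply _ a i j)
  · exact fun t a x x' e f ht ha hx hx' he hf => ⟨by simp [reProduct],
      (eval_products ht ha hx hx' he hf).1.trans (Q.toAutomaton_step_castAdd_castAdd ..).symm⟩
  · exact fun t a x x' e f ht ha hx hx' he hf => ⟨by simp [imProduct],
      (eval_products ht ha hx hx' he hf).2.trans (Q.toAutomaton_step_castAdd_natAdd ..).symm⟩
  · intro t a x x' e f ht ha hx hx' he hf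
    rw [Q.toAutomaton_step_natAdd_castAdd, ← (eval_products ht ha hx hx' he hf).2]
    simp [imProduct]
  · exact fun t a x x' e f ht ha hx hx' he hf => ⟨by simp [reProduct],
      (eval_products ht ha hx hx' he hf).1.trans (Q.toAutomaton_step_natAdd_natAdd ..).symm⟩
  · rw [stepCells_apply, hzero]
    refine Fin.addCases (fun j => ?_) (fun j => ?_) j <;>
      by_cases hj : ∃ x x' : Fin K,
        j = finProdFinEquiv (finProdFinEquiv (a, x), finProdFinEquiv (a, x'))
    · obtain ⟨x, x', rfl⟩ := hj
      exact .inl (Fin.addCases (fun l => .inl ⟨a, x, x', l, rfl, rfl⟩)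
        (fun l => .inr (.inr (.inl ⟨a, x, x', l, rfl, rfl⟩))) i)
    · exact .inr (Q.toAutomaton_step_eq_zero hj i).1.symm
    · obtain ⟨x, x', rfl⟩ := hj
      exact .inl (Fin.addCases (fun l => .inr (.inl ⟨a, x, x', l, rfl, rfl⟩))
        (fun l => .inr (.inr (.inr ⟨a, x, x', l, rfl, rfl⟩))) i)
    · exact .inr (Q.toAutomaton_step_eq_zero hj i).2.symm

/-- Stores a function of two edges, whose numbers are in the registers `10` and `11`, in row `0` of
the array `b` from the column `o` on. -/
def fillDensityRow (y b : ℕ) (o : IExpr) (u : RExpr) : Program :=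
  fill [(10, y + 5), (11, y + 5)] b 0 (o + (.reg 11 + .reg (y + 5) * .reg 10)) u

theorem Fills.fillDensityRow {o : IExpr} {u : RExpr} {N : ℕ} {v : Fin N → ℝ}
    {p : Fin (σ * K * (σ * K)) → Fin N} (hQ : Provides Q y c s) (hb : 10 ≤ b)
    (ho : ∀ t i, Provides Q y c t → o.eval t + i = p i)
    (hu : ∀ t (e f : Fin (σ * K)), Provides Q y c t → t.idx 10 = e.val → t.idx 11 = f.val →
      u.Defined t ∧ u.eval t = v (p (finProdFinEquiv (e, f)))) :
    Fills (fillDensityRow y b o u) s (σ * K * (σ * K)) b (vectorCells v)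
      fun i j => i = 0 ∧ ∃ l, j = p l := by
  have hy := hQ.reg_lt
  have hcounts {t : State} (ht : Counts [(10, y + 5), (11, y + 5)] s t) :=
    hQ.of_counts hb (by simp) ht
  refine (Fills.fill (by simp) (by simp; omega)
    (by simpa [hQ.edges] using Q.card_edges_pos) fun t ht htmem => ?_).mono
    (by simp [hQ.edges]) ?_
  · have hQt := hcounts ht htmem
    obtain ⟨e, he⟩ := ht.exists_fin (x := 10) (by simp) hQ.edges
    obtain ⟨f, hf⟩ := ht.exists_fin (x := 11) (by simp) hQ.edges
    have hcol := ho t (finProdFinEquiv (e, f)) hQt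
    simp only [finProdFinEquiv_apply_val] at hcol
    simp only [IExpr.eval_add, IExpr.eval_mul, IExpr.eval_reg, IExpr.eval_zero, he, hf, hcol,
      hQt.edges, vectorCells_apply]
    exact hu t e f hQt he hf
  · rintro _ _ ⟨rfl, l, rfl⟩
    obtain ⟨⟨e, f⟩, rfl⟩ := finProdFinEquiv.surjective l
    let t := (s.setIdx 10 e).setIdx 11 f
    have ht : Counts [(10, y + 5), (11, y + 5)] s t :=
      ⟨by simp +contextual [t, State.setIdx], by simp [t, State.setIdx, hQ.edges]⟩
    have hQt : Provides Q y c t := hcounts ht fun _ _ => rfl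
    refine ⟨t, ht, rfl, ?_⟩
    simp only [IExpr.eval_add, IExpr.eval_mul, IExpr.eval_reg, hQt.edges, ← ho t _ hQt,
      finProdFinEquiv_apply_val]
    simp [t, State.setIdx]

/-- Stores the initial vector of the automaton of a quantum random walk in row `0` of the array
`b`. -/
def fillDensityInit (y c b : ℕ) : Program :=
  fillDensityRow y b 0
    (.cell (c + 2) 0 (.reg 10) * .cell (c + 2) 0 (.reg 11) +
      .cell (c + 3) 0 (.reg 10) * .cell (c + 3) 0 (.reg 11)) ;;
  fillDensityRow y b (.reg (y + 5) * .reg (y + 5))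
    (.cell (c + 3) 0 (.reg 10) * .cell (c + 2) 0 (.reg 11) -
      .cell (c + 2) 0 (.reg 10) * .cell (c + 3) 0 (.reg 11))

theorem runs_fillDensityInit (hQ : Provides Q y c s) (hb : 10 ≤ b) :
    Runs (fillDensityInit y c b) s (σ * K * (σ * K)) fun μ =>
      vectorOf (μ b) = Q.toAutomaton.init := by
  refine Runs.mono (Fills.seq (.fillDensityRow (p := Fin.castAdd _) hQ hb (fun t i _ => zero_add _)
    fun t e f ht he hf => ?_) fun s₁ hs₁ => .fillDensityRow (p := Fin.natAdd _)
      (hQ.of_frame hs₁ (fun x hx => keepsIdx_fill (by simp; omega))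
        fun A hA => keepsMem_fill (by omega)) hb (fun t i ht => ?_) fun t e f ht he hf => ?_) le_rfl
    fun μ hμ => funext fun l => (hμ 0 l (.inl (Fin.addCases (fun i => .inl ⟨rfl, i, rfl⟩)
      (fun i => .inr ⟨rfl, i, rfl⟩) l))).trans (vectorCells_apply _ l)
  · simp [he, hf, ht.re_ψ₀, ht.im_ψ₀, Q.toAutomaton_init_castAdd, QRW.densityAutomaton]
  · simp [-Fin.natAdd_eq_addNat, ht.edges]
  · simp [-Fin.natAdd_eq_addNat, he, hf, ht.re_ψ₀, ht.im_ψ₀, Q.toAutomaton_init_natAdd,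
      QRW.densityAutomaton, sub_eq_neg_add]

/-- Stores the final vector of the automaton of a quantum random walk, except for the zeros, in
row `0` of the array `b`. -/
def fillDensityFinal (y b : ℕ) : Program :=
  fill [(10, y + 5)] b 0 (.reg 10 + .reg (y + 5) * .reg 10) 1

theorem runs_fillDensityFinal (hQ : Provides Q y c s) (hzero : s.mem b = fun _ _ => 0) :
    Runs (fillDensityFinal y b) s (σ * K) fun μ => vectorOf (μ b) = Q.toAutomaton.final := by
  have hy := hQ.reg_lt
  have hdiag (e : Fin (σ * K)) :=
    vectorCells_apply Q.toAutomaton.final (Fin.castAdd _ (finProdFinEquiv (e, e)))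
  simp only [Fin.val_castAdd, finProdFinEquiv_apply_val] at hdiag
  refine Runs.mono (Fills.fill (Φ := vectorCells Q.toAutomaton.final) (by simp) (by simp; omega)
    (by simpa [hQ.edges] using Q.card_edges_pos) fun t ht _ => ?_) (by simp [hQ.edges])
    fun μ hμ => funext fun l => (hμ 0 l ?_).trans (vectorCells_apply _ l)
  · obtain ⟨e, he⟩ := ht.exists_fin List.mem_cons_self hQ.edges
    have hedges : t.idx (y + 5) = σ * K := (ht.idx _ (by simp; omega)).trans hQ.edges
    simp [he, hedges, hdiag, Q.toAutomaton_final_castAdd]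
  · rw [vectorCells_apply, hzero]
    induction l using Fin.addCases with
    | left l =>
      obtain ⟨⟨e, f⟩, rfl⟩ := finProdFinEquiv.surjective l
      rcases eq_or_ne e f with rfl | hef
      · have hreg : y + 5 ≠ 10 := by omega
        refine .inl ⟨s.setIdx 10 e, ⟨?_, ?_⟩, rfl, ?_⟩ <;>
          simp +contextual [State.setIdx, hQ.edges, hreg]
      · exact .inr ((Q.toAutomaton_final_castAdd e f).trans (if_neg hef)).symm
    | right l => exact .inr (Q.toAutomaton_final_natAdd l).symm

/-- Stores the automaton of a quantum random walk, given in the arrays from number `c` on, in the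
arrays from number `b` on, where the arrays `b` and `b + 2` are zero before. -/
def loadQRW (y c b : ℕ) : Program :=
  fillDensitySteps y c b ;; fillDensityInit y c (b + 1) ;; fillDensityFinal y (b + 2)

theorem keepsIdx_fillDensitySteps {x : ℕ} (hx : x < 10) :
    (fillDensitySteps y c b).keepsIdx x := by
  simp [fillDensitySteps, keepsIdx, keepsIdx_fillDensityBlock hx]

theorem keepsMem_fillDensitySteps {A : ℕ} (hA : A ≠ b) : (fillDensitySteps y c b).keepsMem A := by
  simp [fillDensitySteps, fillDensityBlock, keepsMem, keepsMem_fill hA]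

theorem keepsIdx_fillDensityInit {x : ℕ} (hx : x < 10) : (fillDensityInit y c b).keepsIdx x := by
  have h {o u} : (fillDensityRow y b o u).keepsIdx x := keepsIdx_fill (by simp; omega)
  simp [fillDensityInit, keepsIdx, h]

theorem keepsMem_fillDensityInit {A : ℕ} (hA : A ≠ b) : (fillDensityInit y c b).keepsMem A := by
  simp [fillDensityInit, fillDensityRow, keepsMem, keepsMem_fill hA]

theorem runs_loadQRW (hQ : Provides Q y c s) (hb : 10 ≤ b) (hstep : s.mem b = fun _ _ => 0)
    (hfinal : s.mem (b + 2) = fun _ _ => 0) :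
    Runs (loadQRW y c b) s (σ * (K * (K * (σ * K * (σ * K))))) (Stores Q.toAutomaton b) := by
  have hk := Q.card_edges_pos
  have hcost : σ * K * (σ * K) ≤ σ * (K * (K * (σ * K * (σ * K)))) := by
    rw [← mul_assoc K, ← mul_assoc σ, ← mul_assoc σ]
    exact Nat.le_mul_of_pos_left _ (Nat.mul_pos hk (Nat.pos_of_mul_pos_left hk))
  refine Runs.stores (runs_fillDensitySteps hQ hb hstep) (fun s₁ hs₁ => ?_) (fun s₂ hs₂ => ?_)
    (keepsMem_fillDensityInit (by omega)) (keepsMem_fill (by omega)) (keepsMem_fill (by omega))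
  · exact (runs_fillDensityInit (hQ.of_frame hs₁ (fun _ => keepsIdx_fillDensitySteps)
      fun A hA => keepsMem_fillDensitySteps (by omega)) (by omega)).mono hcost fun _ => id
  · refine (runs_fillDensityFinal (hQ.of_frame hs₂ (fun x hx => ?_) fun A hA => ?_) ?_).mono
      ((Nat.le_mul_of_pos_left _ hk).trans hcost) fun _ => id
    · simp [keepsIdx, keepsIdx_fillDensitySteps hx, keepsIdx_fillDensityInit hx]
    · simp [keepsMem, keepsMem_fillDensitySteps (show A ≠ b by omega),
        keepsMem_fillDensityInit (show A ≠ b + 1 by omega)]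
    · refine (hs₂.mem _ ?_).trans hfinal
      simp [keepsMem, keepsMem_fillDensitySteps, keepsMem_fillDensityInit]

/-- Decides equivalence of two quantum random walks in the input format of `qrwInput`. -/
def decideQRW : Program :=
  (setIdx 6 (.reg 0 * .reg 1) ;; setIdx 7 (.reg 0 * .reg 2) ;;
    setIdx regDimX (.reg 6 * .reg 6 + .reg 6 * .reg 6) ;;
    setIdx regDimY (.reg 7 * .reg 7 + .reg 7 * .reg 7) ;;
    setIdx regDim (.reg regDimX + .reg regDimY) ;;
    loadQRW 1 0 arrX ;; loadQRW 2 4 arrY ;; testEquiv) ;; answer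

theorem loadQRW_cost_le {J N : ℕ} (hσ₁ : 1 ≤ σ) (hN : 1 ≤ N) (hJ : σ * J * (σ * J) ≤ N) :
    σ * (J * (J * (σ * J * (σ * J)))) ≤ σ * N ^ 4 := by
  have hJσ : J ≤ σ * J := Nat.le_mul_of_pos_left _ hσ₁
  calc σ * (J * (J * (σ * J * (σ * J))))
      ≤ σ * (σ * J * (σ * J * (σ * J * (σ * J)))) := by gcongr
    _ = σ * (σ * J * (σ * J)) ^ 2 := by ring
    _ ≤ σ * N ^ 2 := by gcongr
    _ ≤ σ * N ^ 4 := by gcongr; decide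

theorem decideQRW_decidesWithin {K L : ℕ} (QX : QRW σ K) (QY : QRW σ L) :
    DecidesWithin decideQRW (qrwInput QX QY)
      (decideQRW.size * 4 ^ 4 * (σ * max (QRW.stateSpaceDim σ K) (QRW.stateSpaceDim σ L) ^ 4))
      (QX.prob = QY.prob) := by
  have hkX := QX.card_edges_pos
  have hkY := QY.card_edges_pos
  have hσ₁ : 1 ≤ σ := Nat.pos_of_mul_pos_right hkX
  set m := σ * K * (σ * K) + σ * K * (σ * K)
  set n := σ * L * (σ * L) + σ * L * (σ * L)
  have hm₁ : 1 ≤ m := (Nat.mul_pos hkX hkX).trans_le (Nat.le_add_right _ _)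
  have hn₁ : 1 ≤ n := (Nat.mul_pos hkY hkY).trans_le (Nat.le_add_right _ _)
  have hpos : 1 ≤ σ * (m + n) ^ 4 := Nat.mul_pos hσ₁ (Nat.pow_pos (by omega))
  rw [← QX.weight_toAutomaton, ← QY.weight_toAutomaton]
  refine Runs.decidesWithin (.setIdx_seq hpos (.setIdx_seq hpos (.setIdx_seq hpos
    (.setIdx_seq hpos (.setIdx_seq hpos ?_))))) hpos ?_
  · refine runs_load_testEquiv ((runs_loadQRW (c := 0) (Q := QX) ?_ (by decide) rfl rfl).mono
        (loadQRW_cost_le hσ₁ (by omega) (by omega)) fun _ => id)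
      (fun s hs => (runs_loadQRW (c := 4) (Q := QY) ?_ (by decide) (hs.mem _ (by decide))
        (hs.mem _ (by decide))).mono (loadQRW_cost_le hσ₁ (by omega) (by omega)) fun _ => id)
      (by decide) (by decide) (by decide) rfl hσ₁ rfl rfl rfl hm₁ hn₁ rfl rfl
    · exact ⟨by decide, by decide, rfl, rfl, rfl, rfl, rfl, rfl, rfl, rfl⟩
    · refine Provides.of_frame ⟨by decide, by decide, rfl, rfl, rfl, rfl, rfl, rfl, rfl, rfl⟩ hs
        (by decide) (by decide)
  · have hdim : m + n ≤ 4 * max (QRW.stateSpaceDim σ K) (QRW.stateSpaceDim σ L) := by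
      have hX := QRW.sq_le_stateSpaceDim σ K
      have hY := QRW.sq_le_stateSpaceDim σ L
      rw [sq] at hX hY
      omega
    calc decideQRW.size * (σ * (m + n) ^ 4)
        ≤ decideQRW.size *
            (σ * (4 * max (QRW.stateSpaceDim σ K) (QRW.stateSpaceDim σ L)) ^ 4) := by gcongr
      _ = _ := by ring

end QRW

end RealRAM

theorem theorem1 :
    (∃ (P : RealRAM.Program) (C : ℕ), ∀ (σ nX nY : ℕ) (MX : HMM σ nX) (MY : HMM σ nY),
      RealRAM.DecidesWithin P (RealRAM.hmmInput MX MY)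
        (C * (σ * max nX nY ^ 4))
        (MX.prob = MY.prob)) ∧
    (∃ (P : RealRAM.Program) (C : ℕ), ∀ (σ KX KY : ℕ) (QX : QRW σ KX) (QY : QRW σ KY),
      RealRAM.DecidesWithin P (RealRAM.qrwInput QX QY)
        (C * (σ * max (QRW.stateSpaceDim σ KX) (QRW.stateSpaceDim σ KY) ^ 4))
        (QX.prob = QY.prob)) := by
  exact ⟨⟨RealRAM.decideHMM, _, fun _ _ _ => RealRAM.decideHMM_decidesWithin⟩,
    ⟨RealRAM.decideQRW, _, fun _ _ _ => RealRAM.decideQRW_decidesWithin⟩⟩
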